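/- Let $M$ be a compact smooth Riemannian manifold without boundary, of dimension $d\ge 1$. Let $\{f_i\}_{i\in I}$ be a countable family of maps $f_i:M\to M$ such that, for each $i$: - $f_i$ is of class $C^{1+\theta_i}$ for some $\theta_i\in(0,1]$ (it is $C^1$ and, in charts, its derivative is locally $\theta_i$-Hölder); - $f_i$ is expanding: there are $C_i>0$ and $\sigma_i>1$ with $\|D_x(f_i^k)v\|\ge C_i\sigma_i^k\|v\|$ for all $k\ge 0$, $x\in M$, $v\in T_xM$; - $f_i$ is conformal: for each $x\in M$ the derivative $D_xf_i$ is a scalar multiple of a linear isometry $T_xM\to T_{f_i(x)}M$. Let $Y$ be a countable subset of $M$, and put $$E(f_i,Y)=\{z\in M:\ Y\cap\overline{\{f_i^k(z):k\ge 0\}}=\emptyset\}.$$ Then $\bigcap_{i\in I}E(f_i,Y)$ is absolute winning on $M$. Here a set $S\subseteq W$, with $W\subseteq\mathbb R^d$ open, is called absolute winning on $W$ if for every $0<\beta<1/3$ Alice has a winning strategy in the following game. Bob chooses a closed ball $B_1=B(x_1,\rho_1)\subseteq W$ with $\rho_1>0$. After Bob has chosen a closed ball $B_i$ of radius $\rho_i$,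 Alice chooses a point $p_i\in\mathbb R^d$ and a number $0<\epsilon_i\le\beta\rho_i$, and Bob chooses a closed ball $B_{i+1}\subseteq B_i\setminus\{x:|x-p_i|<\epsilon_i\}$ of radius $\rho_{i+1}\ge\beta\rho_i$. Alice wins if $\bigcap_{i}B_i\cap S\neq\emptyset$. A set $S\subseteq M$ is called absolute winning on $M$ if $\varphi(S\cap U)$ is absolute winning on $\varphi(U)$ for every $C^1$ coordinate chart $\varphi:U\to\varphi(U)\subseteq\mathbb R^d$ of $M$. -/

import Mathlib

open Set Function
open scoped Manifold ContDiff Topology NNReal Bundle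

noncomputable section

/-! ### The absolute game on an open subset of Euclidean space -/

/-- A closed ball of `ℝᵈ`, given by its centre and its positive radius: a move of Bob. -/
structure GameBall (d : ℕ) where
  center : EuclideanSpace ℝ (Fin d)
  radius : ℝ
  radius_pos : 0 < radius

/-- The closed ball `B(x, ρ)` as a set of points. -/
def GameBall.toSet {d : ℕ} (B : GameBall d) : Set (EuclideanSpace ℝ (Fin d)) :=
  Metric.closedBall B.center B.radius

/-- A strategy of Alice in the `0`-dimensional `β`-absolute game. After each turn of Bob it reads
the balls `h 0, …, h n` chosen by Bob so far and returns a `0`-dimensional affine subspace of `ℝᵈ`,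
that is a point, together with some `ε` such that `0 < ε ≤ β ρ`, where `ρ` is the radius of Bob's
last ball. -/
structure AliceStrategy (d : ℕ) (β : ℝ) where
  point : ∀ n : ℕ, (Fin (n + 1) → GameBall d) → EuclideanSpace ℝ (Fin d)
  eps : ∀ n : ℕ, (Fin (n + 1) → GameBall d) → ℝ
  eps_pos : ∀ n h, 0 < eps n h
  eps_le : ∀ n h, eps n h ≤ β * (h (Fin.last n)).radius

/-- The set which Alice removes in her `n`-th turn when Bob has played `B 0, …, B n`: the
`ε`-neighbourhood of the point that she has chosen. -/
def AliceStrategy.removed {d : ℕ} {β : ℝ} (σ : AliceStrategy d β) (B : ℕ → GameBall d) (n : ℕ) :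
    Set (EuclideanSpace ℝ (Fin d)) :=
  Metric.ball (σ.point n fun j => B j) (σ.eps n fun j => B j)

/-- `B 0, B 1, …` is a sequence of legal moves of Bob against the strategy `σ` of Alice, in the
`β`-absolute game played on `W`: the first ball lies in `W`, each later ball lies in the previous
one with Alice's set removed, and its radius is at least `β` times the previous radius. -/
def AliceStrategy.IsPlay {d : ℕ} {β : ℝ} (σ : AliceStrategy d β)
    (W : Set (EuclideanSpace ℝ (Fin d))) (B : ℕ → GameBall d) : Prop :=
  (B 0).toSet ⊆ W ∧
    ∀ n, (B (n + 1)).toSet ⊆ (B n).toSet \ σ.removed B n ∧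
      β * (B n).radius ≤ (B (n + 1)).radius

/-- `S` is absolute winning on the open set `W ⊆ ℝᵈ`: for every `0 < β < 1/3` Alice has a strategy
in the `β`-absolute game such that the intersection of Bob's balls always meets `S`. -/
def IsAbsoluteWinningOn {d : ℕ} (W S : Set (EuclideanSpace ℝ (Fin d))) : Prop :=
  ∀ β : ℝ, 0 < β → β < 1 / 3 →
    ∃ σ : AliceStrategy d β, ∀ B : ℕ → GameBall d, σ.IsPlay W B →
      ((⋂ n, (B n).toSet) ∩ S).Nonempty

/-- A subset `S` of a `d`-dimensional `C¹` manifold is absolute winning if its image in every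
`C¹` coordinate chart `φ : U → φ(U) ⊆ ℝᵈ` is absolute winning on the open set `φ(U)`. -/
def IsAbsoluteWinning (d : ℕ) {M : Type*} [TopologicalSpace M]
    [ChartedSpace (EuclideanSpace ℝ (Fin d)) M] (S : Set M) : Prop :=
  ∀ φ ∈ IsManifold.maximalAtlas (𝓡 d) 1 M,
    IsAbsoluteWinningOn φ.target (φ '' (S ∩ φ.source))

/-! ### Maps of a manifold -/

/-- `E(f, Y)`: the points whose forward orbit closure does not meet `Y`. -/
def avoidingSet {M : Type*} [TopologicalSpace M] (f : M → M) (Y : Set M) : Set M :=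
  {z | Y ∩ closure {w | ∃ k : ℕ, f^[k] z = w} = ∅}

/-- `f` is of class `C^{1+θ}`: it is `C¹` and, read in charts, its derivative is locally
`θ`-Hölder. -/
def IsC1Holder (d : ℕ) {M : Type*} [TopologicalSpace M]
    [ChartedSpace (EuclideanSpace ℝ (Fin d)) M] (θ : ℝ≥0) (f : M → M) : Prop :=
  ContMDiff (𝓡 d) (𝓡 d) 1 f ∧
    ∀ x : M, ∃ C : ℝ≥0, ∃ U ∈ 𝓝 (extChartAt (𝓡 d) x x),
      HolderOnWith C θ (fderiv ℝ (writtenInExtChartAt (𝓡 d) (𝓡 d) x f)) U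

/-- `f` is expanding: there are `C > 0` and `σ > 1` such that `‖D_x(f^k) v‖ ≥ C σ^k ‖v‖` for all
`k`, all `x` and all tangent vectors `v` at `x`. -/
def IsExpandingMap (d : ℕ) {M : Type*} [TopologicalSpace M]
    [ChartedSpace (EuclideanSpace ℝ (Fin d)) M]
    [Bundle.RiemannianBundle (fun x : M => TangentSpace (𝓡 d) x)] (f : M → M) : Prop :=
  ∃ C σ : ℝ, 0 < C ∧ 1 < σ ∧ ∀ (k : ℕ) (x : M) (v : TangentSpace (𝓡 d) x),
    C * σ ^ k * ‖v‖ ≤ ‖mfderiv (𝓡 d) (𝓡 d) f^[k] x v‖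

/-- `f` is conformal: each derivative `D_x f` is a scalar multiple of a linear isometry. -/
def IsConformalEndomorphism (d : ℕ) {M : Type*} [TopologicalSpace M]
    [ChartedSpace (EuclideanSpace ℝ (Fin d)) M]
    [Bundle.RiemannianBundle (fun x : M => TangentSpace (𝓡 d) x)] (f : M → M) : Prop :=
  ∀ x : M, ∃ (c : ℝ) (L : TangentSpace (𝓡 d) x →ₗᵢ[ℝ] TangentSpace (𝓡 d) (f x)),
    ∀ v : TangentSpace (𝓡 d) x, mfderiv (𝓡 d) (𝓡 d) f x v = c • L v

end

/-! Conformality turns the derivative of an iterate into a scalar: `‖D_p(f^k) w‖ = Λ_k(p) ‖w‖`,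
where `Λ_k` is a multiplicative cocycle that expansion bounds below by `C σ^k`. The analytic heart
is bounded distortion: as long as `Λ_k(p) dist(p, q)` stays below a fixed threshold, `f^k` acts on
the pair as a similarity of ratio `Λ_k(p)` up to a constant factor. Distances are chordal, pulled
back by a smooth embedding `e` into Euclidean space. Since `e` need not be isometric, chords do not
scale by the conformal factor even to first order; the Riemannian length of the projected chord
does, with relative error of order distance to the power `θ` (`exists_quasiDist`). Read backwards
from the end of an orbit segment, distances decay geometrically by expansion, so these errors are
summable (`exists_quasiDist_iterate_bounds`, `hasBoundedDistortion_of_quasiDist`).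

In the game for one map and one point `y`, time `k` is active at a ball of centre `p` and radius `ρ`
if `Λ_k(p) ρ` lies in a window `[a, b]`. Active times at one ball differ by a bounded amount. If
points of the ball visit a small neighbourhood of `y` at two active times, then `y` almost returns
to itself within that bounded time, hence returns exactly. The two visits can then be compared at
the later time, and distortion pulls them back to nearby points of the ball. So one ball of radius
`βρ` contains every dangerous point (`exists_scale_window`). Every large `k` becomes active at some
turn, so orbits eventually stay away from `y` (`winsShrinkingPlays_eventually_far`).

It remains to exclude exact hits at the finitely many early times: the preimages of `Y` under all
iterates form a countable set, whose points are removed one by one. Countably many goals are met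
together by interleaving strategies (`winsShrinkingPlays_iInter`). All this assumes that Bob's radii
tend to zero; otherwise a fixed ball lies in all his balls, and a virtual shrinking play inside it
supplies the required point (`isAbsoluteWinningOn_of_winsShrinkingPlays`). -/

/-! ### Cocycles and bounded distortion -/

/-- The multiplicative cocycle `∏_{i < k} lam (f^i p)` of a function along the orbits of a map. -/
def cocycleProd {X : Type*} (f : X → X) (lam : X → ℝ) (k : ℕ) (p : X) : ℝ :=
  ∏ i ∈ Finset.range k, lam (f^[i] p)

/-- Along orbit segments which stay short, `f^k` is a similarity of ratio `Lam k` up to a uniform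
multiplicative constant. -/
def HasBoundedDistortion {X : Type*} [MetricSpace X] (f : X → X) (Lam : ℕ → X → ℝ) : Prop :=
  ∃ b K : ℝ, 0 < b ∧ 1 ≤ K ∧ ∀ (k : ℕ) (p q : X), Lam k p * dist p q ≤ b →
    dist (f^[k] p) (f^[k] q) ≤ K * (Lam k p * dist p q) ∧
    Lam k p * dist p q ≤ K * dist (f^[k] p) (f^[k] q) ∧
    Lam k p ≤ K * Lam k q ∧ Lam k q ≤ K * Lam k p

section Cocycle

variable {X : Type*} {f : X → X} {lam : X → ℝ}

theorem cocycleProd_zero (p : X) : cocycleProd f lam 0 p = 1 := by simp [cocycleProd]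

theorem cocycleProd_succ (k : ℕ) (p : X) :
    cocycleProd f lam (k + 1) p = cocycleProd f lam k p * lam (f^[k] p) := by
  simp [cocycleProd, Finset.prod_range_succ]

theorem cocycleProd_add (i m : ℕ) (p : X) :
    cocycleProd f lam (i + m) p = cocycleProd f lam i p * cocycleProd f lam m (f^[i] p) := by
  simp only [cocycleProd, Finset.prod_range_add]
  congr 1
  refine Finset.prod_congr rfl fun j _ => ?_
  rw [add_comm i j, Function.iterate_add_apply]

theorem cocycleProd_pos (hlam : ∀ p, 0 < lam p) (k : ℕ) (p : X) : 0 < cocycleProd f lam k p :=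
  Finset.prod_pos fun _ _ => hlam _

theorem cocycleProd_le_pow {L : ℝ} (hlam : ∀ p, 0 < lam p) (hL : ∀ p, lam p ≤ L) (k : ℕ) (p : X) :
    cocycleProd f lam k p ≤ L ^ k := by
  induction k with
  | zero => simp [cocycleProd]
  | succ k ih =>
    rw [cocycleProd_succ, pow_succ]
    exact mul_le_mul ih (hL _) (hlam _).le ((cocycleProd_pos hlam k p).le.trans ih)

theorem mul_cocycleProd_le {C σ : ℝ}
    (hlam : ∀ p, 0 < lam p) (hexp : ∀ k p, C * σ ^ k ≤ cocycleProd f lam k p) (i m : ℕ) (p : X) :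
    cocycleProd f lam i p * (C * σ ^ m) ≤ cocycleProd f lam (i + m) p := by
  rw [cocycleProd_add]
  exact mul_le_mul_of_nonneg_left (hexp _ _) (cocycleProd_pos hlam i p).le

end Cocycle

/-- Relative errors add along a composition because `(1 - s)(1 - t) ≥ 1 - (s + t)`. -/
theorem mul_one_sub_le_of_relative_error {s t l P x y : ℝ} (hl : 0 ≤ l) (hs : 0 ≤ s) (ht : 0 ≤ t)
    (ht1 : t ≤ 1) (hP : 0 ≤ P) (hx : (1 - s) * P ≤ x) (hy : l * x - t * (l * x) ≤ y) :
    (1 - (s + t)) * (l * P) ≤ y := by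
  have e1 : (1 - t) * l * ((1 - s) * P) ≤ (1 - t) * l * x :=
    mul_le_mul_of_nonneg_left hx (mul_nonneg (by linarith) hl)
  have e2 : 0 ≤ s * t * (l * P) := mul_nonneg (mul_nonneg hs ht) (mul_nonneg hl hP)
  linear_combination e1 + e2 + hy

/-- The upper counterpart: `(1 + 2s)(1 + t) ≤ 1 + 2(s + t)` when `s ≤ 1/2`. The factor two leaves
room for the cross term. -/
theorem le_mul_one_add_of_relative_error {s t l P x y : ℝ} (hl : 0 ≤ l) (hs : s ≤ 1 / 2)
    (ht : 0 ≤ t) (hP : 0 ≤ P) (hx : x ≤ (1 + 2 * s) * P) (hy : y ≤ l * x + t * (l * x)) :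
    y ≤ (1 + 2 * (s + t)) * (l * P) := by
  have e1 : (1 + t) * l * x ≤ (1 + t) * l * ((1 + 2 * s) * P) :=
    mul_le_mul_of_nonneg_left hx (mul_nonneg (by linarith) hl)
  have e2 : 0 ≤ t * (1 - 2 * s) * (l * P) :=
    mul_nonneg (mul_nonneg ht (by linarith)) (mul_nonneg hl hP)
  linear_combination e1 + e2 + hy

/-- The telescoping estimate: one-step errors which decay geometrically along the orbit segment
change the ratio by at most a factor of two. -/
theorem exists_quasiDist_iterate_bounds {X : Type*} [MetricSpace X] {f : X → X} {D : X → X → ℝ}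
    {lam : X → ℝ} {θ r A c C σ : ℝ} (hθ : 0 < θ) (hr : 0 < r) (hA : 0 ≤ A) (hc : 1 ≤ c)
    (hC : 0 < C) (hσ : 1 < σ)
    (hD : ∀ p q, dist p q ≤ r →
      |D (f p) (f q) - lam p * D p q| ≤ A * D p q ^ θ * (lam p * D p q))
    (hDd : ∀ p q, dist p q ≤ r → dist p q ≤ c * D p q ∧ D p q ≤ c * dist p q)
    (hlam : ∀ p, 0 < lam p) (hexp : ∀ k p, C * σ ^ k ≤ cocycleProd f lam k p)
    (hf : UniformContinuous f) :
    ∃ b : ℝ, 0 < b ∧ ∀ (k : ℕ) (p q : X), cocycleProd f lam k p * dist p q ≤ b →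
      ∀ i m : ℕ, i + m = k → dist (f^[i] p) (f^[i] q) ≤ r ∧
        1 / 2 * (cocycleProd f lam i p * D p q) ≤ D (f^[i] p) (f^[i] q) ∧
        D (f^[i] p) (f^[i] q) ≤ 2 * (cocycleProd f lam i p * D p q) := by
  obtain ⟨r₁, hr₁, hfr⟩ := Metric.uniformContinuous_iff.1 hf r hr
  set u : ℝ := (σ⁻¹) ^ θ with hu
  have hσ0 : 0 < σ := by linarith
  have hu0 : 0 < u := Real.rpow_pos_of_pos (by positivity) _
  have hu1 : u < 1 := Real.rpow_lt_one (by positivity) (inv_lt_one_of_one_lt₀ hσ) hθ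
  have hc0 : 0 < c := by linarith
  -- the constant `B` bounds the quasi-distance at the end of the orbit segment
  obtain ⟨B, hB0, hBr, hBr₁, hBA⟩ : ∃ B : ℝ, 0 < B ∧ B ≤ r ∧ c * B < r₁ ∧
      A * B ^ θ * u / (1 - u) ≤ 1 / 2 := by
    have hlim : Filter.Tendsto (fun B : ℝ => A * B ^ θ * u / (1 - u)) (𝓝[>] 0)
        (𝓝 (A * (0 : ℝ) ^ θ * u / (1 - u))) := by
      refine Filter.Tendsto.mono_left ?_ nhdsWithin_le_nhds
      have : ContinuousAt (fun B : ℝ => B ^ θ) 0 :=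
        Real.continuousAt_rpow_const _ _ (Or.inr hθ.le)
      exact ((this.tendsto.const_mul A).mul_const u).div_const _
    rw [Real.zero_rpow hθ.ne'] at hlim
    simp only [mul_zero, zero_mul, zero_div] at hlim
    have h1 := hlim.eventually (Iio_mem_nhds (show (0 : ℝ) < 1 / 2 by norm_num))
    have h2 : ∀ᶠ B : ℝ in 𝓝[>] 0, B < min r (r₁ / c) :=
      nhdsWithin_le_nhds (Iio_mem_nhds (by positivity))
    have h3 : ∀ᶠ B : ℝ in 𝓝[>] 0, 0 < B := self_mem_nhdsWithin
    obtain ⟨B, h1, h2, h3⟩ := (h1.and (h2.and h3)).exists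
    refine ⟨B, h3, (h2.trans_le (min_le_left _ _)).le, ?_, le_of_lt h1⟩
    have := (lt_div_iff₀ hc0).1 (h2.trans_le (min_le_right _ _))
    linarith
  set G := A * B ^ θ with hG
  have hG0 : 0 ≤ G := by positivity
  -- `Q * u ^ m` is the tail sum of `G * u ^ j` over `j > m`: an upper bound for all errors made up
  -- to the moment when `m` iterations remain.
  set Q := G * u / (1 - u) with hQ
  have hQ0 : 0 ≤ Q := div_nonneg (by positivity) (by linarith)
  have hQu : Q + G = Q / u := by
    rw [hQ]; field_simp [(by linarith : (1 : ℝ) - u ≠ 0)]; ring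
  have hb1 : C * B / (2 * c) ≤ C * r₁ := by
    rw [div_le_iff₀ (by positivity)]
    nlinarith [mul_pos hC hB0, mul_le_mul_of_nonneg_left hBr₁.le hC.le, mul_pos hC hr₁, mul_pos (mul_pos hC hr₁) hc0]
  -- The first term makes the quasi-distance with `m` iterations remaining at most `B σ^(-m)`; the
  -- second forces `dist p q ≤ r`, because the cocycle is at least `C`.
  refine ⟨min (C * B / (2 * c)) (C * r), by positivity, fun k p q hk => ?_⟩
  have hΛ := cocycleProd_pos (f := f) hlam
  have hk1 := hk.trans (min_le_left _ _)
  have hk2 := hk.trans (min_le_right _ _)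
  have hd0 : dist p q ≤ r := by
    have h1 : C * 1 ≤ cocycleProd f lam k p :=
      (mul_le_mul_of_nonneg_left (one_le_pow₀ hσ.le) hC.le).trans (hexp k p)
    have : C * dist p q ≤ C * r := by
      nlinarith [mul_le_mul_of_nonneg_right h1 (dist_nonneg (x := p) (y := q))]
    exact le_of_mul_le_mul_left this hC
  have hD0 : 0 ≤ D p q := by
    have := (hDd p q hd0).1
    by_contra hneg
    nlinarith [dist_nonneg (x := p) (y := q), mul_neg_of_pos_of_neg hc0 (not_le.1 hneg)]
  suffices H : ∀ i m : ℕ, i + m = k → dist (f^[i] p) (f^[i] q) ≤ r ∧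
      (1 - Q * u ^ m) * (cocycleProd f lam i p * D p q) ≤ D (f^[i] p) (f^[i] q) ∧
      D (f^[i] p) (f^[i] q) ≤ (1 + 2 * (Q * u ^ m)) * (cocycleProd f lam i p * D p q) by
    intro i m him
    obtain ⟨h1, h2, h3⟩ := H i m him
    have hs : Q * u ^ m ≤ 1 / 2 :=
      (mul_le_of_le_one_right hQ0 (pow_le_one₀ hu0.le hu1.le)).trans hBA
    have hP := mul_nonneg (hΛ i p).le hD0
    exact ⟨h1, (mul_le_mul_of_nonneg_right (by linarith) hP).trans h2,
      h3.trans (mul_le_mul_of_nonneg_right (by linarith) hP)⟩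
  intro i
  induction i with
  | zero =>
    intro m _
    have hs : 0 ≤ Q * u ^ m := by positivity
    simp only [iterate_zero, id_eq, cocycleProd_zero, one_mul]
    refine ⟨hd0, ?_, ?_⟩ <;> nlinarith [mul_nonneg hs hD0]
  | succ i ih =>
    intro m him
    obtain ⟨h1, h2, h3⟩ := ih (m + 1) (by omega)
    set Di := D (f^[i] p) (f^[i] q) with hDi
    set Li := cocycleProd f lam i p with hLi
    have hP : 0 ≤ Li * D p q := mul_nonneg (hΛ i p).le hD0
    have hs0 : 0 ≤ Q * u ^ (m + 1) := by positivity
    have hs : Q * u ^ (m + 1) ≤ 1 / 2 :=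
      (mul_le_of_le_one_right hQ0 (pow_le_one₀ hu0.le hu1.le)).trans hBA
    have hDi0 : 0 ≤ Di := by
      refine le_trans (mul_nonneg ?_ hP) h2; linarith
    -- geometric decay backwards from the end of the segment
    have hdecay : Di ≤ B * (σ⁻¹) ^ (m + 1) := by
      have e1 : Di ≤ 2 * (Li * D p q) :=
        h3.trans (mul_le_mul_of_nonneg_right (by linarith) hP)
      have e2 : Li * (C * σ ^ (m + 1)) ≤ cocycleProd f lam k p := by
        have := mul_cocycleProd_le hlam hexp i (m + 1) p
        rwa [show i + (m + 1) = k by omega] at this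
      have e3 : D p q ≤ c * dist p q := (hDd p q hd0).2
      have e4 : Li * D p q * (C * σ ^ (m + 1)) ≤ c * (C * B / (2 * c)) := by
        calc Li * D p q * (C * σ ^ (m + 1)) = Li * (C * σ ^ (m + 1)) * D p q := by ring
          _ ≤ cocycleProd f lam k p * (c * dist p q) :=
              mul_le_mul e2 e3 hD0 (hΛ k p).le
          _ = c * (cocycleProd f lam k p * dist p q) := by ring
          _ ≤ _ := mul_le_mul_of_nonneg_left hk1 hc0.le
      have e5 : c * (C * B / (2 * c)) = C * B / 2 := by field_simp
      rw [e5] at e4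
      have e6 : Li * D p q * σ ^ (m + 1) ≤ B / 2 := by
        refine le_of_mul_le_mul_left (a := C) ?_ hC
        calc C * (Li * D p q * σ ^ (m + 1)) = Li * D p q * (C * σ ^ (m + 1)) := by ring
          _ ≤ C * B / 2 := e4
          _ = _ := by ring
      rw [inv_pow, ← div_eq_mul_inv, le_div_iff₀ (by positivity)]
      calc Di * σ ^ (m + 1) ≤ 2 * (Li * D p q) * σ ^ (m + 1) :=
            mul_le_mul_of_nonneg_right e1 (by positivity)
        _ = 2 * (Li * D p q * σ ^ (m + 1)) := by ring
        _ ≤ _ := by linarith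
    have hDiB : Di ≤ B := hdecay.trans
      (mul_le_of_le_one_right hB0.le (pow_le_one₀ (by positivity) (inv_le_one_of_one_le₀ hσ.le)))
    have ht : A * Di ^ θ ≤ G * u ^ (m + 1) := by
      have : Di ^ θ ≤ B ^ θ * u ^ (m + 1) := by
        calc Di ^ θ ≤ (B * (σ⁻¹) ^ (m + 1)) ^ θ := Real.rpow_le_rpow hDi0 hdecay hθ.le
          _ = B ^ θ * u ^ (m + 1) := by
            rw [Real.mul_rpow hB0.le (by positivity), hu, ← Real.rpow_natCast,
              ← Real.rpow_mul (by positivity), ← Real.rpow_natCast,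
              ← Real.rpow_mul (by positivity), mul_comm θ]
      calc A * Di ^ θ ≤ A * (B ^ θ * u ^ (m + 1)) := mul_le_mul_of_nonneg_left this hA
        _ = _ := by rw [hG]; ring
    have hdist : dist (f^[i] p) (f^[i] q) < r₁ :=
      ((hDd _ _ h1).1.trans (mul_le_mul_of_nonneg_left hDiB hc0.le)).trans_lt hBr₁
    have hstep := abs_le.1 (hD _ _ h1)
    rw [← hDi] at hstep
    set l := lam (f^[i] p) with hl
    have hl0 : 0 < l := hlam _
    have ht0 : 0 ≤ A * Di ^ θ := by positivity
    have hlD : 0 ≤ l * Di := by positivity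
    have hsum : Q * u ^ (m + 1) + G * u ^ (m + 1) = Q * u ^ m := by
      rw [← add_mul, hQu, pow_succ]; field_simp
    rw [iterate_succ_apply', iterate_succ_apply', cocycleProd_succ, ← hLi, ← hl]
    set s := Q * u ^ (m + 1) with hs_def
    set t := G * u ^ (m + 1) with ht_def
    have ht0' : 0 ≤ t := ht0.trans ht
    rw [← hsum]
    have e1 : A * Di ^ θ * (l * Di) ≤ t * (l * Di) := mul_le_mul_of_nonneg_right ht hlD
    have hPl : Li * l * D p q = l * (Li * D p q) := by ring
    have ht1 : t ≤ 1 := by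
      have : s + t ≤ 1 / 2 := by
        rw [hsum]; exact (mul_le_of_le_one_right hQ0 (pow_le_one₀ hu0.le hu1.le)).trans hBA
      linarith
    rw [hPl]
    exact ⟨(hfr hdist).le, mul_one_sub_le_of_relative_error hl0.le hs0 ht0' ht1 hP h2
      (by linarith), le_mul_one_add_of_relative_error hl0.le hs ht0' hP h3 (by linarith)⟩

/-- The comparison of `dist (f^[k] p) (f^[k] q)` with the cocycle at `p` is inherited from the
quasi-distance. The cocycles at `p` and `q` are then comparable because the same estimate, started
from `q`, measures the same distance. -/
theorem hasBoundedDistortion_of_quasiDist {X : Type*} [MetricSpace X] {f : X → X} {D : X → X → ℝ}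
    {lam : X → ℝ} {θ r A c C σ L : ℝ} (hθ : 0 < θ) (hr : 0 < r) (hA : 0 ≤ A) (hc : 1 ≤ c)
    (hC : 0 < C) (hσ : 1 < σ)
    (hD : ∀ p q, dist p q ≤ r →
      |D (f p) (f q) - lam p * D p q| ≤ A * D p q ^ θ * (lam p * D p q))
    (hDd : ∀ p q, dist p q ≤ r → dist p q ≤ c * D p q ∧ D p q ≤ c * dist p q)
    (hlam : ∀ p, 0 < lam p) (hL : ∀ p, lam p ≤ L)
    (hexp : ∀ k p, C * σ ^ k ≤ cocycleProd f lam k p)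
    (hf : UniformContinuous f) :
    HasBoundedDistortion f (cocycleProd f lam) := by
  obtain ⟨b, hb, H⟩ := exists_quasiDist_iterate_bounds hθ hr hA hc hC hσ hD hDd hlam hexp hf
  have hΛ := cocycleProd_pos (f := f) hlam
  set K := 2 * c ^ 2 with hK
  have hc0 : 0 < c := by linarith
  have hK1 : 1 ≤ K := by nlinarith
  have hdist : ∀ (k : ℕ) (p q : X), cocycleProd f lam k p * dist p q ≤ b → ∀ i m, i + m = k →
      dist (f^[i] p) (f^[i] q) ≤ K * (cocycleProd f lam i p * dist p q) ∧
      cocycleProd f lam i p * dist p q ≤ K * dist (f^[i] p) (f^[i] q) := by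
    intro k p q hk i m him
    obtain ⟨h1, h2, h3⟩ := H k p q hk i m him
    have h0 := (H k p q hk 0 k (by omega)).1
    simp only [iterate_zero, id_eq] at h0
    obtain ⟨g1, g2⟩ := hDd _ _ h0
    obtain ⟨g3, g4⟩ := hDd _ _ h1
    have hp := hΛ i p
    constructor
    · calc dist (f^[i] p) (f^[i] q) ≤ c * D (f^[i] p) (f^[i] q) := g3
        _ ≤ c * (2 * (cocycleProd f lam i p * (c * dist p q))) :=
          mul_le_mul_of_nonneg_left (h3.trans (by gcongr)) hc0.le
        _ = _ := by rw [hK]; ring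
    · calc cocycleProd f lam i p * dist p q ≤ cocycleProd f lam i p * (c * D p q) := by gcongr
        _ = 2 * c * (1 / 2 * (cocycleProd f lam i p * D p q)) := by ring
        _ ≤ 2 * c * (c * dist (f^[i] p) (f^[i] q)) :=
          mul_le_mul_of_nonneg_left (h2.trans g4) (by positivity)
        _ = _ := by rw [hK]; ring
  have hL0 : ∀ p : X, 0 < L := fun p => (hlam p).trans_le (hL p)
  by_cases hX : Nonempty X
  swap
  · exact ⟨1, 1, one_pos, le_rfl, fun k p => (hX ⟨p⟩).elim⟩
  obtain ⟨p₀⟩ := hX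
  have hLpos := hL0 p₀
  -- The third term feeds the bootstrap below, where a step may cost the factor `L` and the passage
  -- from `p` to `q` costs `K ^ 2`.
  refine ⟨min b (min (C * b) (C * b / (L * K ^ 2))), K ^ 2, by positivity, by nlinarith, ?_⟩
  intro k p q hk
  have hk1 := hk.trans (min_le_left _ _)
  have hk2 := hk.trans ((min_le_right _ _).trans (min_le_left _ _))
  have hk3 := hk.trans ((min_le_right _ _).trans (min_le_right _ _))
  obtain ⟨d1, d2⟩ := hdist k p q hk1 k 0 (by omega)
  have hKK : K ≤ K ^ 2 := by nlinarith
  have hdn := dist_nonneg (x := p) (y := q)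
  refine ⟨d1.trans (mul_le_mul_of_nonneg_right hKK (mul_nonneg (hΛ k p).le hdn)),
    d2.trans (mul_le_mul_of_nonneg_right hKK dist_nonneg), ?_⟩
  rcases eq_or_ne p q with rfl | hpq
  · constructor <;> nlinarith [hΛ k p]
  have hd : 0 < dist p q := dist_pos.2 hpq
  have hCΛ : ∀ i m, i + m = k → C * (cocycleProd f lam i p * dist p q) ≤
      cocycleProd f lam k p * dist p q := by
    intro i m him
    have e1 := mul_cocycleProd_le hlam hexp i m p
    rw [him] at e1
    have e2 : cocycleProd f lam i p * C ≤ cocycleProd f lam i p * (C * σ ^ m) :=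
      mul_le_mul_of_nonneg_left (le_mul_of_one_le_right hC.le (one_le_pow₀ hσ.le)) (hΛ i p).le
    nlinarith [mul_le_mul_of_nonneg_right (e2.trans e1) hdn]
  -- Smallness at `q` is bootstrapped in time. At time `i` it allows the estimates from `p` and from
  -- `q` to be compared, which improves the bound to `b / L`; one more step multiplies by at most
  -- `L`.
  have hq : ∀ i m, i + m = k → cocycleProd f lam i q * dist q p ≤ b := by
    intro i
    induction i with
    | zero =>
      intro m him
      have := (hCΛ 0 m him).trans hk2
      rw [cocycleProd_zero] at this ⊢
      rw [dist_comm]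
      exact le_of_mul_le_mul_left this hC
    | succ i ih =>
      intro m him
      have e1 := (hdist i q p (ih (m + 1) (by omega)) i 0 (by omega)).2
      have e2 := (hdist k p q hk1 i (m + 1) (by omega)).1
      have e3 := (hCΛ i (m + 1) (by omega)).trans hk3
      rw [dist_comm (f^[i] q)] at e1
      have e4 : cocycleProd f lam i q * dist q p ≤ K ^ 2 * (cocycleProd f lam i p * dist p q) :=
        by
        rw [pow_two, mul_assoc]
        exact e1.trans (mul_le_mul_of_nonneg_left e2 (by linarith))
      have e5 : cocycleProd f lam i p * dist p q ≤ b / (L * K ^ 2) := by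
        refine le_of_mul_le_mul_left (a := C) ?_ hC
        rwa [← mul_div_assoc]
      rw [cocycleProd_succ]
      calc cocycleProd f lam i q * lam (f^[i] q) * dist q p
          = lam (f^[i] q) * (cocycleProd f lam i q * dist q p) := by ring
        _ ≤ L * (K ^ 2 * (b / (L * K ^ 2))) := by
          refine mul_le_mul (hL _) (e4.trans (mul_le_mul_of_nonneg_left e5 (by positivity))) ?_ hLpos.le
          exact mul_nonneg (hΛ i q).le dist_nonneg
        _ = b := by field_simp
  obtain ⟨q1, q2⟩ := hdist k q p (hq k 0 (by omega)) k 0 (by omega)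
  rw [dist_comm (f^[k] q), dist_comm q] at q1 q2
  constructor
  · refine le_of_mul_le_mul_right ?_ hd
    calc cocycleProd f lam k p * dist p q ≤ K * (K * (cocycleProd f lam k q * dist p q)) :=
          d2.trans (mul_le_mul_of_nonneg_left q1 (by linarith))
      _ = _ := by ring
  · refine le_of_mul_le_mul_right ?_ hd
    calc cocycleProd f lam k q * dist p q ≤ K * (K * (cocycleProd f lam k p * dist p q)) :=
          q2.trans (mul_le_mul_of_nonneg_left d1 (by linarith))
      _ = _ := by ring

/-! ### The absolute game: interleaving and reduction to shrinking radii -/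

section Game

variable {d : ℕ}

/-- Alice can force every point which lies in all balls of Bob into `S`, as long as Bob lets his
radii shrink to zero. -/
def WinsShrinkingPlays (β : ℝ) (W S : Set (EuclideanSpace ℝ (Fin d))) : Prop :=
  ∃ σ : AliceStrategy d β, ∀ B : ℕ → GameBall d, σ.IsPlay W B →
    Filter.Tendsto (fun n => (B n).radius) Filter.atTop (𝓝 0) →
      ∀ x, (∀ n, x ∈ (B n).toSet) → x ∈ S

theorem WinsShrinkingPlays.mono {β : ℝ} {W S T : Set (EuclideanSpace ℝ (Fin d))}
    (h : WinsShrinkingPlays β W S) (hST : W ∩ S ⊆ T) : WinsShrinkingPlays β W T := by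
  obtain ⟨σ, hσ⟩ := h
  exact ⟨σ, fun B hB hr x hx => hST ⟨hB.1 (hx 0), hσ B hB hr x hx⟩⟩

/-- A strategy which only depends on the first and on the last ball of Bob. -/
theorem winsShrinkingPlays_of_positional {β : ℝ} (hβ : 0 < β)
    {W S : Set (EuclideanSpace ℝ (Fin d))}
    (H : ∀ b₀ : GameBall d, b₀.toSet ⊆ W → ∃ P : GameBall d → EuclideanSpace ℝ (Fin d),
      ∀ B : ℕ → GameBall d, B 0 = b₀ →
        (∀ n, (B (n + 1)).toSet ⊆ (B n).toSet \ Metric.ball (P (B n)) (β * (B n).radius)) →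
        (∀ n, β * (B n).radius ≤ (B (n + 1)).radius) →
        Filter.Tendsto (fun n => (B n).radius) Filter.atTop (𝓝 0) →
        ∀ x, (∀ n, x ∈ (B n).toSet) → x ∈ S) :
    WinsShrinkingPlays β W S := by
  choose! P hP using H
  refine ⟨⟨fun n h => P (h 0) (h (Fin.last n)), fun n h => β * (h (Fin.last n)).radius,
    fun n h => mul_pos hβ (GameBall.radius_pos _), fun n h => le_rfl⟩, ?_⟩
  intro B hB hr x hx
  exact hP (B 0) hB.1 B rfl (fun n => (hB.2 n).1) (fun n => (hB.2 n).2) hr x hx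

theorem winsShrinkingPlays_univ {β : ℝ} (hβ : 0 < β) (W : Set (EuclideanSpace ℝ (Fin d))) :
    WinsShrinkingPlays β W univ :=
  winsShrinkingPlays_of_positional hβ fun _ _ => ⟨fun _ => 0, by simp⟩

theorem winsShrinkingPlays_compl_singleton {β : ℝ} (hβ : 0 < β)
    (W : Set (EuclideanSpace ℝ (Fin d))) (z : EuclideanSpace ℝ (Fin d)) :
    WinsShrinkingPlays β W {z}ᶜ := by
  refine winsShrinkingPlays_of_positional hβ fun b₀ _ => ⟨fun _ => z, ?_⟩
  rintro B - hB - - x hx rfl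
  exact (hB 0 (hx 1)).2 (Metric.mem_ball_self (mul_pos hβ (B 0).radius_pos))

/-! #### Countable intersections -/

theorem AliceStrategy.IsPlay.antitone {β : ℝ} {σ : AliceStrategy d β}
    {W : Set (EuclideanSpace ℝ (Fin d))} {B : ℕ → GameBall d} (h : σ.IsPlay W B) :
    Antitone fun n => (B n).toSet :=
  antitone_nat_of_succ_le fun n => (h.2 n).1.trans sdiff_subset

theorem AliceStrategy.IsPlay.pow_mul_radius_le {β : ℝ} (hβ : 0 < β) {σ : AliceStrategy d β}
    {W : Set (EuclideanSpace ℝ (Fin d))} {B : ℕ → GameBall d} (h : σ.IsPlay W B) (n m : ℕ) :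
    β ^ m * (B n).radius ≤ (B (n + m)).radius := by
  induction m with
  | zero => simp
  | succ m ih =>
    calc β ^ (m + 1) * (B n).radius = β * (β ^ m * (B n).radius) := by ring
      _ ≤ β * (B (n + m)).radius := mul_le_mul_of_nonneg_left ih hβ.le
      _ ≤ _ := (h.2 (n + m)).2

/-- The turn at which the `i`-th strategy moves for the `k`-th time. -/
def interleavedTurn (i k : ℕ) : ℕ := 2 ^ i * (2 * k + 1) - 1

theorem interleavedTurn_add_one (i k : ℕ) : interleavedTurn i k + 1 = 2 ^ i * (2 * k + 1) := by
  have : 0 < 2 ^ i * (2 * k + 1) := by positivity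
  unfold interleavedTurn; omega

theorem interleavedTurn_succ (i k : ℕ) :
    interleavedTurn i (k + 1) = interleavedTurn i k + 2 ^ (i + 1) := by
  have h1 := interleavedTurn_add_one i (k + 1)
  have h2 := interleavedTurn_add_one i k
  have : 2 ^ i * (2 * (k + 1) + 1) = 2 ^ i * (2 * k + 1) + 2 ^ (i + 1) := by ring
  omega

theorem strictMono_interleavedTurn (i : ℕ) : StrictMono (interleavedTurn i) :=
  strictMono_nat_of_lt_succ fun k => by
    rw [interleavedTurn_succ]; exact Nat.lt_add_of_pos_right (by positivity)

theorem padicValNat_interleavedTurn (i k : ℕ) :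
    padicValNat 2 (interleavedTurn i k + 1) = i := by
  rw [interleavedTurn_add_one, padicValNat.mul (by positivity) (by omega),
    padicValNat.prime_pow, padicValNat.eq_zero_of_not_dvd (by omega), add_zero]

theorem interleavedTurn_div (i k : ℕ) : (interleavedTurn i k + 1) / 2 ^ (i + 1) = k := by
  rw [interleavedTurn_add_one, pow_succ, Nat.mul_div_mul_left _ _ (by positivity)]
  omega

/-- Play countably many strategies in turn; the `i`-th one moves once in `2 ^ (i + 1)` turns. -/
def AliceStrategy.interleave {β : ℝ} (hβ : 0 < β)
    (σ : ∀ i : ℕ, AliceStrategy d (β ^ 2 ^ (i + 1))) : AliceStrategy d β where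
  point n h := (σ (padicValNat 2 (n + 1))).point ((n + 1) / 2 ^ (padicValNat 2 (n + 1) + 1))
    fun j => h ⟨min (interleavedTurn (padicValNat 2 (n + 1)) j) n, by omega⟩
  -- Legality must hold for every history, hence the cap. At the turns of a strategy the cap has no
  -- effect, since its own parameter is at most `β`.
  eps n h := min (β * (h (Fin.last n)).radius)
    ((σ (padicValNat 2 (n + 1))).eps ((n + 1) / 2 ^ (padicValNat 2 (n + 1) + 1))
      fun j => h ⟨min (interleavedTurn (padicValNat 2 (n + 1)) j) n, by omega⟩)
  eps_pos n h := lt_min (mul_pos hβ (GameBall.radius_pos _)) ((σ _).eps_pos _ _)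
  eps_le n h := min_le_left _ _

theorem AliceStrategy.removed_interleave {β : ℝ} (hβ : 0 < β) (hβ1 : β ≤ 1)
    (σ : ∀ i : ℕ, AliceStrategy d (β ^ 2 ^ (i + 1))) (B : ℕ → GameBall d) (i k : ℕ) :
    (AliceStrategy.interleave hβ σ).removed B (interleavedTurn i k) =
      (σ i).removed (fun l => B (interleavedTurn i l)) k := by
  have hmin : (fun j : Fin (k + 1) => B (min (interleavedTurn i j) (interleavedTurn i k))) =
      fun j : Fin (k + 1) => B (interleavedTurn i j) := by
    funext j
    rw [min_eq_left ((strictMono_interleavedTurn i).monotone (Nat.lt_succ_iff.1 j.2))]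
  have heps : (σ i).eps k (fun j => B (interleavedTurn i j)) ≤
      β * (B (interleavedTurn i k)).radius := by
    refine ((σ i).eps_le k _).trans ?_
    refine mul_le_mul_of_nonneg_right ?_ (GameBall.radius_pos _).le
    exact pow_le_of_le_one hβ.le hβ1 (by positivity)
  simp only [AliceStrategy.removed, AliceStrategy.interleave]
  rw [padicValNat_interleavedTurn, interleavedTurn_div, hmin]
  simp only [Fin.val_last]
  rw [min_eq_right heps]

theorem winsShrinkingPlays_iInter_nat {β : ℝ} (hβ : 0 < β) (hβ3 : β < 1 / 3)
    {W : Set (EuclideanSpace ℝ (Fin d))} {S : ℕ → Set (EuclideanSpace ℝ (Fin d))}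
    (H : ∀ i, ∀ β' : ℝ, 0 < β' → β' < 1 / 3 → WinsShrinkingPlays β' W (S i)) :
    WinsShrinkingPlays β W (⋂ i, S i) := by
  have hβi : ∀ i : ℕ, β ^ 2 ^ (i + 1) ≤ β := fun i =>
    pow_le_of_le_one hβ.le (by linarith) (by positivity)
  -- Between consecutive moves of the `i`-th strategy there are `2 ^ (i + 1)` turns, in which Bob
  -- may shrink his radius by `β` to that power. This is the parameter of the game that this
  -- strategy sees.
  choose σ hσ using fun i : ℕ => H i (β ^ 2 ^ (i + 1)) (by positivity) ((hβi i).trans_lt hβ3)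
  refine ⟨AliceStrategy.interleave hβ σ, fun B hB hr x hx => mem_iInter.2 fun i => ?_⟩
  refine hσ i (fun l => B (interleavedTurn i l)) ⟨?_, fun k => ⟨?_, ?_⟩⟩
    (hr.comp (strictMono_interleavedTurn i).tendsto_atTop) x fun n => hx _
  · exact (hB.antitone (Nat.zero_le _)).trans hB.1
  · rw [← AliceStrategy.removed_interleave hβ (by linarith) σ B i k]
    exact (hB.antitone (strictMono_interleavedTurn i (Nat.lt_succ_self k))).trans (hB.2 _).1
  · simp only [interleavedTurn_succ]
    exact hB.pow_mul_radius_le hβ _ _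

theorem winsShrinkingPlays_iInter {β : ℝ} (hβ : 0 < β) (hβ3 : β < 1 / 3) {ι : Type*} [Countable ι]
    {W : Set (EuclideanSpace ℝ (Fin d))} {S : ι → Set (EuclideanSpace ℝ (Fin d))}
    (H : ∀ i, ∀ β' : ℝ, 0 < β' → β' < 1 / 3 → WinsShrinkingPlays β' W (S i)) :
    WinsShrinkingPlays β W (⋂ i, S i) := by
  rcases isEmpty_or_nonempty ι with hι | hι
  · rw [iInter_of_empty]; exact winsShrinkingPlays_univ hβ W
  · obtain ⟨e, he⟩ := exists_surjective_nat ι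
    rw [← he.iInter_comp]
    exact winsShrinkingPlays_iInter_nat hβ hβ3 fun i => H (e i)

/-! #### Plays whose radii do not shrink -/

/-- Test the inclusion on the point of the inner ball farthest from `y`. -/
theorem dist_add_le_of_closedBall_subset {E : Type*} [NormedAddCommGroup E] [NormedSpace ℝ E]
    [Nontrivial E] {x y : E} {r s : ℝ} (hr : 0 ≤ r)
    (h : Metric.closedBall x r ⊆ Metric.closedBall y s) : dist x y + r ≤ s := by
  obtain ⟨u, hu, hxy⟩ : ∃ u : E, ‖u‖ = 1 ∧ x - y = ‖x - y‖ • u := by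
    rcases eq_or_ne x y with rfl | hne
    · obtain ⟨u, hu⟩ := exists_norm_eq E zero_le_one
      exact ⟨u, hu, by simp⟩
    · have : ‖x - y‖ ≠ 0 := norm_ne_zero_iff.2 (sub_ne_zero.2 hne)
      exact ⟨‖x - y‖⁻¹ • (x - y), by rw [norm_smul, norm_inv, norm_norm, inv_mul_cancel₀ this],
        by rw [smul_smul, mul_inv_cancel₀ this, one_smul]⟩
  have hmem : x + r • u ∈ Metric.closedBall x r := by
    simp [norm_smul, hu, abs_of_nonneg hr]
  have := h hmem
  rw [Metric.mem_closedBall, dist_eq_norm,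
    show x + r • u - y = (‖x - y‖ + r) • u by rw [add_smul, ← hxy]; abel, norm_smul, hu, mul_one,
    Real.norm_of_nonneg (by positivity)] at this
  rwa [dist_eq_norm]

/-- Bob always has a legal move: of two antipodal candidate centres, `2(1 - β)ρ` apart, one is at
distance at least `(1 - β)ρ > 2βρ` from `p`. This is where `β < 1/3` enters. -/
theorem exists_closedBall_subset_diff_ball {E : Type*} [NormedAddCommGroup E] [NormedSpace ℝ E]
    [Nontrivial E] {β : ℝ} (hβ3 : β < 1 / 3) (x p : E) {ρ : ℝ} (hρ : 0 < ρ) :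
    ∃ c : E, Metric.closedBall c (β * ρ) ⊆ Metric.closedBall x ρ \ Metric.ball p (β * ρ) := by
  obtain ⟨u, hu⟩ := exists_norm_eq E (show 0 ≤ (1 - β) * ρ by nlinarith)
  obtain ⟨c, hc, hcp⟩ : ∃ c, dist c x = (1 - β) * ρ ∧ 2 * (β * ρ) < dist c p := by
    by_contra! hcon
    have h1 := hcon (x + u) (by simp [hu])
    have h2 := hcon (x - u) (by simp [hu])
    have h3 : dist (x + u) (x - u) = 2 * ((1 - β) * ρ) := by
      rw [dist_eq_norm, show x + u - (x - u) = (2 : ℝ) • u by rw [two_smul]; abel, norm_smul, hu]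
      simp
    have := dist_triangle_right (x + u) (x - u) p
    nlinarith
  refine ⟨c, fun z hz => ⟨?_, fun hz' => ?_⟩⟩
  · rw [Metric.mem_closedBall] at hz ⊢
    have := dist_triangle z c x
    linarith
  · rw [Metric.mem_closedBall] at hz
    rw [Metric.mem_ball] at hz'
    have := dist_triangle_left c p z
    linarith

/-- Bob answers with radius exactly `β` times the previous one, so the radii shrink geometrically.
-/
theorem exists_play_of_subset [Nontrivial (EuclideanSpace ℝ (Fin d))] {β : ℝ} (hβ : 0 < β)
    (hβ3 : β < 1 / 3) (σ : AliceStrategy d β) {W : Set (EuclideanSpace ℝ (Fin d))}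
    (b : GameBall d) (hb : b.toSet ⊆ W) :
    ∃ B : ℕ → GameBall d, B 0 = b ∧ σ.IsPlay W B ∧
      Filter.Tendsto (fun n => (B n).radius) Filter.atTop (𝓝 0) := by
  choose c hc using fun (b : GameBall d) (p : EuclideanSpace ℝ (Fin d)) =>
    exists_closedBall_subset_diff_ball hβ3 b.center p b.radius_pos
  let next : GameBall d → EuclideanSpace ℝ (Fin d) → GameBall d := fun b p =>
    ⟨c b p, β * b.radius, mul_pos hβ b.radius_pos⟩
  -- The recursion builds whole histories, because the strategy may read all earlier balls.
  let hist : ∀ n : ℕ, Fin (n + 1) → GameBall d := fun n => Nat.rec (fun _ => b)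
    (fun n h => Fin.snoc (α := fun _ => GameBall d) h (next (h (Fin.last n)) (σ.point n h))) n
  have hsucc : ∀ n, hist (n + 1) = Fin.snoc (α := fun _ => GameBall d) (hist n)
      (next (hist n (Fin.last n)) (σ.point n (hist n))) := fun n => rfl
  set B : ℕ → GameBall d := fun n => hist n (Fin.last n) with hBdef
  have hhist : ∀ n, hist n = fun j : Fin (n + 1) => B j := by
    intro n
    induction n with
    | zero => funext j; rw [Fin.fin_one_eq_zero j]; rfl
    | succ n ih =>
      funext j
      refine Fin.lastCases ?_ (fun j => ?_) j
      · rfl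
      · rw [hsucc, Fin.snoc_castSucc, ih]; rfl
  have hB : ∀ n, B (n + 1) = next (B n) (σ.point n fun j : Fin (n + 1) => B j) := by
    intro n
    rw [← hhist n, hBdef]
    simp only [hsucc, Fin.snoc_last]
  refine ⟨B, rfl, ⟨hb, fun n => ⟨?_, ?_⟩⟩, ?_⟩
  · rw [hB]
    refine (hc (B n) _).trans (sdiff_subset_sdiff_right ?_)
    exact Metric.ball_subset_ball (σ.eps_le n _)
  · rw [hB]
  · have : ∀ n, (B n).radius = β ^ n * b.radius := by
      intro n
      induction n with
      | zero => simp [hBdef, hist]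
      | succ n ih =>
        rw [hB]; change β * (B n).radius = _; rw [ih]; ring
    simp only [this]
    simpa using (tendsto_pow_atTop_nhds_zero_of_lt_one hβ.le (by linarith : β < 1)).mul_const
      b.radius

theorem nonempty_iInter_toSet {B : ℕ → GameBall d} (hB : Antitone fun n => (B n).toSet) :
    (⋂ n, (B n).toSet).Nonempty :=
  IsCompact.nonempty_iInter_of_sequence_nonempty_isCompact_isClosed _
    (fun n => hB n.le_succ) (fun n => ⟨_, Metric.mem_closedBall_self (B n).radius_pos.le⟩)
    (isCompact_closedBall _ _) fun _ => Metric.isClosed_closedBall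

/-- Nested radii decrease to a limit `r > 0`. The balls with the same centres and radii reduced by
`r` are still nested; a common point of these is the centre of a ball of radius `r` inside every
ball of Bob. -/
theorem exists_ball_subset_of_not_tendsto [Nontrivial (EuclideanSpace ℝ (Fin d))]
    {B : ℕ → GameBall d} (hB : Antitone fun n => (B n).toSet)
    (hr : ¬ Filter.Tendsto (fun n => (B n).radius) Filter.atTop (𝓝 0)) :
    ∃ b : GameBall d, ∀ n, b.toSet ⊆ (B n).toSet := by
  have hsub : ∀ n, dist (B (n + 1)).center (B n).center + (B (n + 1)).radius ≤ (B n).radius :=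
    fun n => dist_add_le_of_closedBall_subset (B (n + 1)).radius_pos.le (hB n.le_succ)
  have hanti : Antitone fun n => (B n).radius := antitone_nat_of_succ_le fun n => by
    have := hsub n
    have := dist_nonneg (x := (B (n + 1)).center) (y := (B n).center)
    linarith
  have hbdd : BddBelow (range fun n => (B n).radius) :=
    ⟨0, by rintro _ ⟨n, rfl⟩; exact (B n).radius_pos.le⟩
  have hlim := tendsto_atTop_ciInf hanti hbdd
  set r := ⨅ n, (B n).radius with hr_def
  have hr0 : 0 ≤ r := le_ciInf fun n => (B n).radius_pos.le
  have hrpos : 0 < r := hr0.lt_of_ne fun h => hr (by rwa [h])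
  have hrle : ∀ n, r ≤ (B n).radius := fun n => ciInf_le hbdd n
  obtain ⟨x, hx⟩ := IsCompact.nonempty_iInter_of_sequence_nonempty_isCompact_isClosed
    (fun n => Metric.closedBall (B n).center ((B n).radius - r))
    (fun n => Metric.closedBall_subset_closedBall' (by have := hsub n; linarith))
    (fun n => ⟨_, Metric.mem_closedBall_self (sub_nonneg.2 (hrle n))⟩)
    (isCompact_closedBall _ _) fun _ => Metric.isClosed_closedBall
  refine ⟨⟨x, r, hrpos⟩, fun n => Metric.closedBall_subset_closedBall' ?_⟩
  have := Metric.mem_closedBall.1 (mem_iInter.1 hx n)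
  change r + dist x (B n).center ≤ _
  linarith

/-- If the radii do not shrink, the same strategy is played afresh against a fictitious Bob starting
from a ball contained in all the real ones. The point obtained lies in `S` and in every real ball.
-/
theorem isAbsoluteWinningOn_of_winsShrinkingPlays (hd : 1 ≤ d)
    {W S : Set (EuclideanSpace ℝ (Fin d))}
    (H : ∀ β : ℝ, 0 < β → β < 1 / 3 → WinsShrinkingPlays β W S) : IsAbsoluteWinningOn W S := by
  have : Nonempty (Fin d) := ⟨⟨0, hd⟩⟩
  intro β hβ hβ3
  obtain ⟨σ, hσ⟩ := H β hβ hβ3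
  refine ⟨σ, fun B hB => ?_⟩
  by_cases hr : Filter.Tendsto (fun n => (B n).radius) Filter.atTop (𝓝 0)
  · obtain ⟨x, hx⟩ := nonempty_iInter_toSet hB.antitone
    exact ⟨x, hx, hσ B hB hr x (mem_iInter.1 hx)⟩
  · obtain ⟨b, hb⟩ := exists_ball_subset_of_not_tendsto hB.antitone hr
    obtain ⟨B', rfl, hB', hr'⟩ := exists_play_of_subset hβ hβ3 σ b ((hb 0).trans hB.1)
    obtain ⟨x, hx⟩ := nonempty_iInter_toSet hB'.antitone
    have hx' := mem_iInter.1 hx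
    exact ⟨x, mem_iInter.2 fun n => hb n (hx' 0), hσ B' hB' hr' x hx'⟩

end Game

/-! ### Alice's strategy against one map and one point -/

section ExpandingGame

variable {X : Type*} [MetricSpace X] {f : X → X} {lam : X → ℝ}

theorem exists_window_length {C σ : ℝ} (hC : 0 < C) (hσ : 1 < σ) (R : ℝ) :
    ∃ N : ℕ, ∀ j : ℕ, C * σ ^ j ≤ R → j ≤ N := by
  obtain ⟨N, hN⟩ := pow_unbounded_of_one_lt (R / C) hσ
  refine ⟨N, fun j hj => ?_⟩
  by_contra! hlt
  have h1 : σ ^ N ≤ σ ^ j := pow_le_pow_right₀ hσ.le hlt.le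
  have h2 := (div_lt_iff₀ hC).1 hN
  nlinarith

/-- Among finitely many times, the non-zero return distances have a positive minimum. This upgrades
an approximate return of `y` to exact periodicity. -/
theorem exists_return_gap (f : X → X) (y : X) (N : ℕ) :
    ∃ η : ℝ, 0 < η ∧ ∀ j ≤ N, dist (f^[j] y) y < η → f^[j] y = y := by
  induction N with
  | zero => exact ⟨1, one_pos, fun j hj _ => by obtain rfl : j = 0 := by omega
                                                rfl⟩
  | succ N ih =>
    obtain ⟨η, hη, H⟩ := ih
    by_cases h : f^[N + 1] y = y
    · refine ⟨η, hη, fun j hj hd => ?_⟩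
      rcases Nat.le_succ_iff.1 hj with hj | rfl
      exacts [H j hj hd, h]
    · refine ⟨min η (dist (f^[N + 1] y) y), lt_min hη (dist_pos.2 h), fun j hj hd => ?_⟩
      rcases Nat.le_succ_iff.1 hj with hj | rfl
      exacts [H j hj (hd.trans_le (min_le_left _ _)),
        absurd (hd.trans_le (min_le_right _ _)) (lt_irrefl _)]

theorem exists_uniform_iterate_continuity (hf : Continuous f) (y : X) (N : ℕ) {ε : ℝ}
    (hε : 0 < ε) : ∃ δ : ℝ, 0 < δ ∧ ∀ j ≤ N, ∀ u, dist u y < δ → dist (f^[j] u) (f^[j] y) < ε := by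
  have h : ∀ᶠ u in 𝓝 y, ∀ j ∈ Finset.range (N + 1), dist (f^[j] u) (f^[j] y) < ε :=
    (Finset.eventually_all _).2 fun j _ =>
      ((hf.iterate j).tendsto y).eventually (Metric.ball_mem_nhds _ hε)
  obtain ⟨δ, hδ, H⟩ := Metric.eventually_nhds_iff.1 h
  exact ⟨δ, hδ, fun j hj u hu => H hu j (Finset.mem_range.2 (by omega))⟩

/-- A window `[a, b]` of scales: during a game every large `k` satisfies `Lam k * ρ ∈ [a, b]` at some
turn, and all points of a ball of Bob which come close to `y` at some time of the window are close
to each other. -/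
theorem exists_scale_window {C σ β c : ℝ} (hf : Continuous f) (hlam : ∀ p, 0 < lam p)
    (hC : 0 < C) (hσ : 1 < σ) (hexp : ∀ k p, C * σ ^ k ≤ cocycleProd f lam k p)
    (hdist : HasBoundedDistortion f (cocycleProd f lam)) (y : X)
    (hβ : 0 < β) (hβ1 : β < 1) (hc : 1 ≤ c) :
    ∃ a b δ : ℝ, 0 < a ∧ 0 < b ∧ 0 < δ ∧
      (∀ (k : ℕ) (p q : X) (ρ ρ' : ℝ), 0 < ρ → β * ρ ≤ ρ' → dist p q ≤ c * ρ →
        b < cocycleProd f lam k q * ρ → cocycleProd f lam k p * ρ' ≤ b →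
        a ≤ cocycleProd f lam k p * ρ') ∧
      (∀ (k k' : ℕ) (p q q' : X) (ρ : ℝ), 0 < ρ → dist p q ≤ c * ρ → dist p q' ≤ c * ρ →
        cocycleProd f lam k p * ρ ∈ Icc a b → cocycleProd f lam k' p * ρ ∈ Icc a b →
        dist (f^[k] q) y < δ → dist (f^[k'] q') y < δ → c * dist q q' < β * ρ) := by
  obtain ⟨b₀, K, hb₀, hK, H⟩ := hdist
  have hΛ := cocycleProd_pos (f := f) hlam
  have hK0 : 0 < K := by linarith
  have hc0 : 0 < c := by linarith
  -- The window will have ratio `b / a = K / β`, whatever `b` is. Hence `N`, and the return gap `η`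
  -- for `N`, can be fixed before `b`.
  obtain ⟨N, hN⟩ := exists_window_length hC hσ (K / β)
  obtain ⟨η, hη, hret⟩ := exists_return_gap f y N
  -- The first bound keeps the ball, and also the previous ball up to a factor `1 / β`, within the
  -- range of bounded distortion; the second gives images of diameter at most `η / 4` at active
  -- times.
  set b := min (b₀ * β / (2 * c * K)) (η / (8 * c * K)) with hb
  have hbpos : 0 < b := by positivity
  have hb1 : 2 * c * K * b ≤ b₀ * β := by
    have := min_le_left (b₀ * β / (2 * c * K)) (η / (8 * c * K))
    rw [← hb, le_div_iff₀ (by positivity)] at this; linarith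
  have hb2 : 8 * c * K * b ≤ η := by
    have := min_le_right (b₀ * β / (2 * c * K)) (η / (8 * c * K))
    rw [← hb, le_div_iff₀ (by positivity)] at this; linarith
  have hb3 : 2 * c * K * b ≤ b₀ := hb1.trans (mul_le_of_le_one_right hb₀.le hβ1.le)
  have hcb : c * b ≤ 2 * c * K * b := by nlinarith [mul_pos hc0 hbpos]
  set a := β * b / K with ha
  have hapos : 0 < a := by positivity
  have haK : a * K = β * b := by rw [ha]; field_simp
  -- The first bound serves the periodicity argument; the second makes `2ε`-close images pull back
  -- to within `βρ / (2c)`.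
  set ε := min (η / 4) (β * a / (4 * c * K ^ 2)) with hε
  have hεpos : 0 < ε := by positivity
  have hε1 : ε ≤ η / 4 := min_le_left _ _
  have hε2 : ε * (4 * c * K ^ 2) ≤ β * a :=
    (le_div_iff₀ (by positivity)).1 (min_le_right (η / 4) (β * a / (4 * c * K ^ 2)))
  obtain ⟨δ₀, hδ₀, hδ⟩ := exists_uniform_iterate_continuity hf y N hεpos
  have key : ∀ (k j : ℕ) (p q q' : X) (ρ : ℝ), 0 < ρ → dist p q ≤ c * ρ → dist p q' ≤ c * ρ →
      cocycleProd f lam k p * ρ ∈ Icc a b → cocycleProd f lam (k + j) p * ρ ∈ Icc a b →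
      dist (f^[k] q) y < min δ₀ ε → dist (f^[k + j] q') y < min δ₀ ε →
      c * dist q q' < β * ρ := by
    intro k j p q q' ρ hρ hq hq' hk hk' hqy hqy'
    -- the two times differ by at most `N`
    have hj : j ≤ N := by
      refine hN j ?_
      have h1 := mul_cocycleProd_le hlam hexp k j p
      have h2 : a * (C * σ ^ j) ≤ b :=
        calc a * (C * σ ^ j) ≤ cocycleProd f lam k p * ρ * (C * σ ^ j) :=
              mul_le_mul_of_nonneg_right hk.1 (by positivity)
          _ = cocycleProd f lam k p * (C * σ ^ j) * ρ := by ring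
          _ ≤ cocycleProd f lam (k + j) p * ρ := mul_le_mul_of_nonneg_right h1 hρ.le
          _ ≤ b := hk'.2
      rw [le_div_iff₀ hβ]
      refine le_of_mul_le_mul_left ?_ hbpos
      calc b * (C * σ ^ j * β) = a * (C * σ ^ j) * K := by linear_combination -(C * σ ^ j) * haK
        _ ≤ b * K := mul_le_mul_of_nonneg_right h2 hK0.le
    set Λ := cocycleProd f lam (k + j) p with hΛdef
    have hΛp : 0 < Λ := hΛ _ _
    have hscale : ∀ z, dist p z ≤ c * ρ → Λ * dist p z ≤ c * b := fun z hz =>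
      calc Λ * dist p z ≤ Λ * (c * ρ) := mul_le_mul_of_nonneg_left hz hΛp.le
        _ = c * (Λ * ρ) := by ring
        _ ≤ c * b := mul_le_mul_of_nonneg_left hk'.2 hc0.le
    obtain ⟨q1, -, q2, q3⟩ := H (k + j) p q ((hscale q hq).trans (hcb.trans hb3))
    obtain ⟨q1', -, -, -⟩ := H (k + j) p q' ((hscale q' hq').trans (hcb.trans hb3))
    have hnear : dist (f^[k + j] q) (f^[k + j] q') ≤ η / 4 := by
      have h1 := mul_le_mul_of_nonneg_left (hscale q hq) hK0.le
      have h2 := mul_le_mul_of_nonneg_left (hscale q' hq') hK0.le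
      have := dist_triangle_left (f^[k + j] q) (f^[k + j] q') (f^[k + j] p)
      linarith
    have hshift : dist (f^[k + j] q) (f^[j] y) < ε := by
      have := hδ j hj _ (hqy.trans_le (min_le_left _ _))
      rwa [← Function.iterate_add_apply, add_comm j k] at this
    have hy' : dist (f^[k + j] q') y < ε := hqy'.trans_le (min_le_right _ _)
    -- The point `f^[k + j] q` is `ε`-close to `f^[j] y`, and `η / 4`-close to `f^[k + j] q'`, which
    -- is `ε`-close to `y`. The total is below the return gap.
    have hper : f^[j] y = y := by
      refine hret j hj ?_
      have h1 := dist_triangle (f^[j] y) (f^[k + j] q) y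
      have h2 := dist_triangle (f^[k + j] q) (f^[k + j] q') y
      rw [dist_comm (f^[j] y) (f^[k + j] q)] at h1
      linarith
    rw [hper] at hshift
    have hclose : dist (f^[k + j] q) (f^[k + j] q') < 2 * ε := by
      have := dist_triangle_right (f^[k + j] q) (f^[k + j] q') y
      linarith
    have hqq' : dist q q' ≤ 2 * (c * ρ) := by
      have := dist_triangle_left q q' p; linarith
    have hsc : cocycleProd f lam (k + j) q * dist q q' ≤ b₀ :=
      calc cocycleProd f lam (k + j) q * dist q q' ≤ K * Λ * (2 * (c * ρ)) :=
            mul_le_mul q3 hqq' dist_nonneg (by positivity)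
        _ = 2 * c * K * (Λ * ρ) := by ring
        _ ≤ 2 * c * K * b := mul_le_mul_of_nonneg_left hk'.2 (by positivity)
        _ ≤ b₀ := hb3
    have hexpand := (H (k + j) q q' hsc).2.1
    have hfin : a * dist q q' ≤ K ^ 2 * ρ * (2 * ε) :=
      calc a * dist q q' ≤ Λ * ρ * dist q q' := mul_le_mul_of_nonneg_right hk'.1 dist_nonneg
        _ ≤ K * cocycleProd f lam (k + j) q * ρ * dist q q' := by gcongr
        _ = K * ρ * (cocycleProd f lam (k + j) q * dist q q') := by ring
        _ ≤ K * ρ * (K * (2 * ε)) := mul_le_mul_of_nonneg_left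
            (hexpand.trans (mul_le_mul_of_nonneg_left hclose.le hK0.le)) (by positivity)
        _ = _ := by ring
    refine lt_of_mul_lt_mul_left (a := a) ?_ hapos.le
    have e1 := mul_le_mul_of_nonneg_left hfin hc0.le
    have e2 := mul_le_mul_of_nonneg_right hε2 hρ.le
    have e3 : 0 < β * a * ρ := by positivity
    linear_combination e1 + 1 / 2 * e2 + 1 / 2 * e3
  refine ⟨a, b, min δ₀ ε, hapos, hbpos, by positivity, ?_, ?_⟩
  · intro k p q ρ ρ' hρ hρρ' hpq hbig hsmall
    have hp := hΛ k p
    have h1 : cocycleProd f lam k p * (β * ρ) ≤ b :=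
      (mul_le_mul_of_nonneg_left hρρ' hp.le).trans hsmall
    have h2 : cocycleProd f lam k p * dist p q ≤ b₀ := by
      refine le_of_mul_le_mul_right ?_ hβ
      calc cocycleProd f lam k p * dist p q * β ≤ cocycleProd f lam k p * (c * ρ) * β := by gcongr
        _ = c * (cocycleProd f lam k p * (β * ρ)) := by ring
        _ ≤ c * b := mul_le_mul_of_nonneg_left h1 hc0.le
        _ ≤ b₀ * β := hcb.trans hb1
    have h3 := (H k p q h2).2.2.2
    rw [ha, div_le_iff₀ hK0]
    calc β * b ≤ β * (cocycleProd f lam k q * ρ) := mul_le_mul_of_nonneg_left hbig.le hβ.le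
      _ ≤ β * (K * cocycleProd f lam k p * ρ) := by gcongr
      _ = K * cocycleProd f lam k p * (β * ρ) := by ring
      _ ≤ K * cocycleProd f lam k p * ρ' := mul_le_mul_of_nonneg_left hρρ' (by positivity)
      _ = _ := by ring
  · intro k k' p q q' ρ hρ hq hq' hk hk' hqy hqy'
    rcases le_total k k' with h | h
    · obtain ⟨j, rfl⟩ := Nat.exists_eq_add_of_le h
      exact key k j p q q' ρ hρ hq hq' hk hk' hqy hqy'
    · obtain ⟨j, rfl⟩ := Nat.exists_eq_add_of_le h
      rw [dist_comm]
      exact key k' j p q' q ρ hρ hq' hq hk' hk hqy' hqy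

theorem winsShrinkingPlays_eventually_far {d : ℕ} {C σ β L : ℝ} (hf : Continuous f)
    (hlam : ∀ p, 0 < lam p) (hL : ∀ p, lam p ≤ L) (hC : 0 < C) (hσ : 1 < σ)
    (hexp : ∀ k p, C * σ ^ k ≤ cocycleProd f lam k p)
    (hdist : HasBoundedDistortion f (cocycleProd f lam)) (y : X) (hβ : 0 < β) (hβ1 : β < 1)
    {W : Set (EuclideanSpace ℝ (Fin d))} (g : EuclideanSpace ℝ (Fin d) → X)
    (hg : ∀ b : GameBall d, b.toSet ⊆ W → ∃ c : ℝ, 1 ≤ c ∧ ∀ x ∈ b.toSet, ∀ x' ∈ b.toSet,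
      dist (g x) (g x') ≤ c * dist x x' ∧ dist x x' ≤ c * dist (g x) (g x')) :
    WinsShrinkingPlays β W {x | ∃ δ > 0, ∃ k₀ : ℕ, ∀ k ≥ k₀, δ ≤ dist (f^[k] (g x)) y} := by
  refine winsShrinkingPlays_of_positional hβ fun b₀ hb₀ => ?_
  obtain ⟨c, hc, hgc⟩ := hg b₀ hb₀
  obtain ⟨a, b, δ, ha, hb, hδ, hwin, hclose⟩ :=
    exists_scale_window hf hlam hC hσ hexp hdist y hβ hβ1 hc
  -- The dangerous points of a ball, over all active times. They all lie within `β` times the radius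
  -- of any one of them, so Alice may aim at an arbitrary one.
  let bad : GameBall d → Set (EuclideanSpace ℝ (Fin d)) := fun b' =>
    {x | x ∈ b'.toSet ∧ ∃ k, cocycleProd f lam k (g b'.center) * b'.radius ∈ Icc a b ∧
      dist (f^[k] (g x)) y < δ}
  classical
  refine ⟨fun b' => if h : (bad b').Nonempty then h.some else b'.center, ?_⟩
  intro B hB0 hB hBr hr x hx
  have hanti : Antitone fun n => (B n).toSet :=
    antitone_nat_of_succ_le fun n => (hB n).trans sdiff_subset
  have hcen : ∀ n, (B n).center ∈ (B n).toSet := fun n =>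
    Metric.mem_closedBall_self (B n).radius_pos.le
  have hsub : ∀ n, (B n).toSet ⊆ b₀.toSet := fun n => hB0 ▸ hanti (Nat.zero_le n)
  have hgd : ∀ n, ∀ z ∈ (B n).toSet, dist (g (B n).center) (g z) ≤ c * (B n).radius := by
    intro n z hz
    refine (hgc _ (hsub n (hcen n)) _ (hsub n hz)).1.trans ?_
    rw [dist_comm]
    exact mul_le_mul_of_nonneg_left hz (by linarith)
  -- For `k ≥ k₀` the scale of the first ball is still above the window, so the window is entered
  -- during the play and cannot be missed at the start.
  obtain ⟨k₀, hk₀⟩ := pow_unbounded_of_one_lt (b / (C * (B 0).radius)) hσ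
  have hρ0 := (B 0).radius_pos
  refine ⟨δ, hδ, k₀, fun k hk => ?_⟩
  by_contra! hnear
  have hstart : b < cocycleProd f lam k (g (B 0).center) * (B 0).radius := by
    have h1 := (div_lt_iff₀ (by positivity)).1 hk₀
    have h2 : σ ^ k₀ ≤ σ ^ k := pow_le_pow_right₀ hσ.le hk
    calc b < σ ^ k₀ * (C * (B 0).radius) := h1
      _ ≤ σ ^ k * (C * (B 0).radius) := by gcongr
      _ = C * σ ^ k * (B 0).radius := by ring
      _ ≤ _ := mul_le_mul_of_nonneg_right (hexp _ _) hρ0.le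
  have hsmall : ∃ n, cocycleProd f lam k (g (B n).center) * (B n).radius ≤ b := by
    have h1 : Filter.Tendsto (fun n => L ^ k * (B n).radius) Filter.atTop (𝓝 0) := by
      simpa using hr.const_mul (L ^ k)
    obtain ⟨n, hn⟩ := (h1.eventually (Iio_mem_nhds hb)).exists
    exact ⟨n, (mul_le_mul_of_nonneg_right (cocycleProd_le_pow hlam hL k _)
      (B n).radius_pos.le).trans (le_of_lt hn)⟩
  -- The first turn at which the scale for `k` is at most `b`. The preceding scale exceeds `b`, so
  -- by the choice of `a` the window is not jumped over.
  obtain ⟨n, hn, hmin⟩ : ∃ n, cocycleProd f lam k (g (B (n + 1)).center) * (B (n + 1)).radius ≤ b ∧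
      b < cocycleProd f lam k (g (B n).center) * (B n).radius := by
    obtain ⟨n, hn⟩ : ∃ n, Nat.find hsmall = n + 1 := by
      refine Nat.exists_eq_succ_of_ne_zero fun h0 => ?_
      have := Nat.find_spec hsmall
      rw [h0] at this
      linarith
    refine ⟨n, ?_, ?_⟩
    · have := Nat.find_spec hsmall; rwa [hn] at this
    · exact not_le.1 (Nat.find_min hsmall (m := n) (by omega))
  have hactive : cocycleProd f lam k (g (B (n + 1)).center) * (B (n + 1)).radius ∈ Icc a b := by
    refine ⟨hwin k _ (g (B n).center) _ _ (B n).radius_pos (hBr n) ?_ hmin hn, hn⟩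
    rw [dist_comm]
    exact hgd n _ (hanti n.le_succ (hcen (n + 1)))
  have hbad : (bad (B (n + 1))).Nonempty := ⟨x, hx _, k, hactive, hnear⟩
  have hrem := (hB (n + 1) (hx (n + 1 + 1))).2
  simp only [dif_pos hbad] at hrem
  obtain ⟨hz, k', hk', hz'⟩ := hbad.some_mem
  refine hrem ?_
  rw [Metric.mem_ball]
  exact ((hgc _ (hsub _ (hx (n + 1))) _ (hsub _ hz)).2).trans_lt
    (hclose k k' _ _ _ _ (B (n + 1)).radius_pos (hgd _ _ (hx _)) (hgd _ _ hz) hactive hk'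
      hnear hz')

/-- Bounded distortion makes every iterate uniformly locally injective. -/
theorem countable_iterate_preimage_singleton [CompactSpace X] {L : ℝ} (hlam : ∀ p, 0 < lam p)
    (hL : ∀ p, lam p ≤ L) (hdist : HasBoundedDistortion f (cocycleProd f lam)) (k : ℕ) (y : X) :
    {z | f^[k] z = y}.Countable := by
  rcases isEmpty_or_nonempty X with hX | ⟨⟨p₀⟩⟩
  · exact (Set.subsingleton_of_subsingleton).countable
  obtain ⟨b, K, hb, hK, H⟩ := hdist
  have hL0 : 0 < L := (hlam p₀).trans_le (hL p₀)
  have hr : 0 < b / L ^ k / 2 := by positivity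
  obtain ⟨t, ht, hcov⟩ := Metric.totallyBounded_iff.1
    (isCompact_univ (X := X)).totallyBounded _ hr
  have hsub : {z | f^[k] z = y} ⊆
      ⋃ x ∈ t, {z | f^[k] z = y} ∩ Metric.ball x (b / L ^ k / 2) := by
    intro z hz
    obtain ⟨x, hx, hzx⟩ := mem_iUnion₂.1 (hcov (mem_univ z))
    exact mem_iUnion₂.2 ⟨x, hx, hz, hzx⟩
  refine (ht.countable.biUnion fun x _ => Set.Subsingleton.countable ?_).mono hsub
  rintro p ⟨hp, hpx⟩ q ⟨hq, hqx⟩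
  rw [Metric.mem_ball] at hpx hqx
  have hd : dist p q ≤ b / L ^ k := by
    have := dist_triangle_right p q x; linarith
  have hs : cocycleProd f lam k p * dist p q ≤ b :=
    calc cocycleProd f lam k p * dist p q ≤ L ^ k * (b / L ^ k) :=
          mul_le_mul (cocycleProd_le_pow hlam hL k p) hd dist_nonneg (by positivity)
      _ = b := by field_simp
  have h1 := (H k p q hs).2.1
  rw [show f^[k] p = f^[k] q from hp.trans hq.symm, dist_self, mul_zero] at h1
  have h2 := cocycleProd_pos (f := f) hlam k p
  exact dist_le_zero.1 (nonpos_of_mul_nonpos_right h1 h2)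

end ExpandingGame

/-! ### Taylor estimates and bi-Lipschitz bounds in normed spaces -/

section Taylor

variable {E F G : Type*} [NormedAddCommGroup E] [NormedSpace ℝ E] [NormedAddCommGroup F]
  [NormedSpace ℝ F] [NormedAddCommGroup G] [NormedSpace ℝ G]

/-- First order Taylor expansion with a remainder `O(‖y - x‖ ^ (1 + θ))`, uniform in both points
near `x₀`. -/
def HasTaylorBoundAt (θ : ℝ) (h : E → F) (x₀ : E) : Prop :=
  ∃ A : ℝ, 0 ≤ A ∧ ∃ V ∈ 𝓝 x₀, ∀ x ∈ V, ∀ y ∈ V,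
    ‖h y - h x - fderiv ℝ h x (y - x)‖ ≤ A * ‖y - x‖ ^ θ * ‖y - x‖

/-- The mean value inequality on the segment from `x` to `y`, where the derivative differs from its
value at `x` by at most `C ‖y - x‖ ^ θ`. -/
theorem HasTaylorBoundAt.of_holderOnWith {h : E → F} {x₀ : E} {C θ : ℝ≥0} {U : Set E}
    (hU : U ∈ 𝓝 x₀) (hC : HolderOnWith C θ (fderiv ℝ h) U)
    (hd : ∀ᶠ x in 𝓝 x₀, DifferentiableAt ℝ h x) : HasTaylorBoundAt θ h x₀ := by
  obtain ⟨r, hr, hsub⟩ := Metric.mem_nhds_iff.1 (Filter.inter_mem hU hd)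
  refine ⟨C, C.2, Metric.ball x₀ r, Metric.ball_mem_nhds _ hr, fun x hx y hy => ?_⟩
  have hseg : segment ℝ x y ⊆ Metric.ball x₀ r := (convex_ball x₀ r).segment_subset hx hy
  refine Convex.norm_image_sub_le_of_norm_fderiv_le' (𝕜 := ℝ) (s := segment ℝ x y)
    (fun z hz => (hsub (hseg hz)).2) (fun z hz => ?_) (convex_segment x y)
    (left_mem_segment ℝ x y) (right_mem_segment ℝ x y)
  have h1 := hC.dist_le (hsub (hseg hz)).1 (hsub hx).1
  rw [dist_eq_norm, dist_eq_norm] at h1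
  refine h1.trans ?_
  gcongr
  obtain ⟨s, ⟨hs0, hs1⟩, rfl⟩ := (segment_eq_image' ℝ x y).subset hz
  rw [add_sub_cancel_left, norm_smul, Real.norm_of_nonneg hs0]
  exact mul_le_of_le_one_left (norm_nonneg _) hs1

theorem HasTaylorBoundAt.of_contDiffAt {h : E → F} {x₀ : E} (hh : ContDiffAt ℝ 2 h x₀) :
    HasTaylorBoundAt 1 h x₀ := by
  obtain ⟨K, U, hU, hK⟩ := (hh.fderiv_right (m := 1) (by norm_num)).exists_lipschitzOnWith
  have hd : ∀ᶠ x in 𝓝 x₀, DifferentiableAt ℝ h x :=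
    (hh.eventually (by simp)).mono fun x hx => hx.differentiableAt (by simp)
  have := HasTaylorBoundAt.of_holderOnWith (θ := 1) hU (holderOnWith_one.2 hK) hd
  simpa using this

theorem eventually_norm_fderiv_le {h : E → F} {x₀ : E} (hh : ContDiffAt ℝ 1 h x₀) :
    ∃ A : ℝ, 0 ≤ A ∧ ∀ᶠ x in 𝓝 x₀, ‖fderiv ℝ h x‖ ≤ A := by
  have hc : ContinuousAt (fun x => ‖fderiv ℝ h x‖) x₀ :=
    (hh.fderiv_right (m := 0) (by norm_num)).continuousAt.norm
  exact ⟨‖fderiv ℝ h x₀‖ + 1, by positivity,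
    (hc.eventually (Iio_mem_nhds (lt_add_one _))).mono fun x hx => le_of_lt hx⟩

theorem HasTaylorBoundAt.comp {h : F → G} {k : E → F} {x₀ : E} {θ : ℝ} (hθ : θ ≤ 1)
    (hh : ContDiffAt ℝ 2 h (k x₀)) (hk : ContDiffAt ℝ 1 k x₀) (hkT : HasTaylorBoundAt θ k x₀) :
    HasTaylorBoundAt θ (h ∘ k) x₀ := by
  obtain ⟨A, hA, V, hV, hkV⟩ := hkT
  obtain ⟨A', hA', V', hV', hhV⟩ := HasTaylorBoundAt.of_contDiffAt hh
  obtain ⟨L, U, hU, hL⟩ := hk.exists_lipschitzOnWith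
  obtain ⟨B, hB, hBU⟩ := eventually_norm_fderiv_le (hh.of_le (by norm_num))
  have hdk : ∀ᶠ x in 𝓝 x₀, DifferentiableAt ℝ k x :=
    (hk.eventually (by simp)).mono fun x hx => hx.differentiableAt (by simp)
  have hdh : ∀ᶠ z in 𝓝 (k x₀), DifferentiableAt ℝ h z :=
    (hh.eventually (by simp)).mono fun x hx => hx.differentiableAt (by simp)
  have hkc := hk.continuousAt
  -- Radius `1 / 2` gives `‖y - x‖ ≤ 1`, so that quadratic errors are absorbed into those of order
  -- `1 + θ`.
  have hball : Metric.ball x₀ (1 / 2) ∈ 𝓝 x₀ := Metric.ball_mem_nhds _ (by norm_num)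
  have hall : ∀ᶠ x in 𝓝 x₀, (x ∈ V ∧ x ∈ U ∧ k x ∈ V' ∧ x ∈ Metric.ball x₀ (1 / 2)) ∧
      ‖fderiv ℝ h (k x)‖ ≤ B ∧ DifferentiableAt ℝ k x ∧ DifferentiableAt ℝ h (k x) := by
    filter_upwards [hV, hU, hkc hV', hball, hkc.eventually hBU, hdk, hkc.eventually hdh]
      with x h1 h2 h3 h4 h5 h6 h7 using ⟨⟨h1, h2, h3, h4⟩, h5, h6, h7⟩
  refine ⟨A' * L ^ 2 + B * A, by positivity, _, hall, ?_⟩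
  rintro x ⟨⟨hxV, hxU, hxV', hxb⟩, hxB, hxk, hxh⟩ y ⟨⟨hyV, hyU, hyV', hyb⟩, -⟩
  have hxy : ‖y - x‖ ≤ 1 := by
    rw [← dist_eq_norm]
    rw [Metric.mem_ball] at hxb hyb
    have := dist_triangle_right y x x₀
    linarith
  have hpow : ‖y - x‖ ≤ ‖y - x‖ ^ θ := by
    rcases (norm_nonneg (y - x)).eq_or_lt with h0 | h0
    · rw [← h0]; positivity
    · simpa using Real.rpow_le_rpow_of_exponent_ge h0 hxy hθ
  have e1 : ‖k y - k x‖ ≤ L * ‖y - x‖ := by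
    simpa [dist_eq_norm] using hL.dist_le_mul y hyU x hxU
  have e2 := hhV _ hxV' _ hyV'
  rw [Real.rpow_one] at e2
  have e3 := hkV x hxV y hyV
  rw [fderiv_comp x hxh hxk]
  set R := k y - k x - fderiv ℝ k x (y - x)
  have hdecomp : (h ∘ k) y - (h ∘ k) x - ((fderiv ℝ h (k x)).comp (fderiv ℝ k x)) (y - x) =
      (h (k y) - h (k x) - fderiv ℝ h (k x) (k y - k x)) + fderiv ℝ h (k x) R := by
    simp only [R, map_sub, comp_apply, ContinuousLinearMap.comp_apply]
    abel
  rw [hdecomp]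
  refine (norm_add_le _ _).trans ?_
  have e4 : ‖fderiv ℝ h (k x) R‖ ≤ B * (A * ‖y - x‖ ^ θ * ‖y - x‖) :=
    (ContinuousLinearMap.le_opNorm _ _).trans (mul_le_mul hxB e3 (norm_nonneg _) hB)
  have e5 : A' * ‖k y - k x‖ * ‖k y - k x‖ ≤ A' * (L * ‖y - x‖) * (L * ‖y - x‖) := by gcongr
  have e6 : A' * L ^ 2 * (‖y - x‖ * ‖y - x‖) ≤ A' * L ^ 2 * (‖y - x‖ ^ θ * ‖y - x‖) := by gcongr
  linear_combination e2 + e4 + e5 + e6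

theorem HasTaylorBoundAt.congr {h k : E → F} {x₀ : E} {θ : ℝ} (hh : HasTaylorBoundAt θ h x₀)
    (hk : k =ᶠ[𝓝 x₀] h) : HasTaylorBoundAt θ k x₀ := by
  obtain ⟨A, hA, V, hV, H⟩ := hh
  refine ⟨A, hA, V ∩ {x | k x = h x ∧ fderiv ℝ k x = fderiv ℝ h x},
    Filter.inter_mem hV (hk.and hk.fderiv), ?_⟩
  rintro x ⟨hx, hkx, hdx⟩ y ⟨hy, hky, -⟩
  rw [hkx, hky, hdx]
  exact H x hx y hy

theorem exists_norm_le_mul_norm_of_injective [FiniteDimensional ℝ E] (T : E →L[ℝ] F)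
    (hT : Injective T) : ∃ c : ℝ, 0 < c ∧ ∀ u, c * ‖u‖ ≤ ‖T u‖ := by
  obtain ⟨K, hK, hanti⟩ := T.toLinearMap.exists_antilipschitzWith (LinearMap.ker_eq_bot.2 hT)
  refine ⟨(K : ℝ)⁻¹, by positivity, fun u => ?_⟩
  rw [inv_mul_le_iff₀ (by positivity)]
  simpa using hanti.le_mul_dist u 0

theorem eventually_mul_norm_le_norm_fderiv [FiniteDimensional ℝ E] {h : E → F} {x₀ : E}
    (hh : ContDiffAt ℝ 1 h x₀) (hinj : Injective (fderiv ℝ h x₀)) :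
    ∃ a : ℝ, 0 < a ∧ ∀ᶠ x in 𝓝 x₀, ∀ u, a * ‖u‖ ≤ ‖fderiv ℝ h x u‖ := by
  obtain ⟨c, hc, hcT⟩ := exists_norm_le_mul_norm_of_injective _ hinj
  have hcont : ContinuousAt (fderiv ℝ h) x₀ :=
    (hh.fderiv_right (m := 0) (by norm_num)).continuousAt
  refine ⟨c / 2, by positivity, ?_⟩
  filter_upwards [hcont (Metric.ball_mem_nhds _ (half_pos hc))] with x hx u
  rw [mem_preimage, Metric.mem_ball, dist_eq_norm] at hx
  have h1 := (fderiv ℝ h x - fderiv ℝ h x₀).le_of_opNorm_le hx.le u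
  have h2 : ‖fderiv ℝ h x₀ u‖ ≤ ‖fderiv ℝ h x u‖ + ‖(fderiv ℝ h x - fderiv ℝ h x₀) u‖ := by
    have := norm_sub_le (fderiv ℝ h x u) ((fderiv ℝ h x - fderiv ℝ h x₀) u)
    simpa using this
  linarith [hcT u]

/-- By strict differentiability, increments differ from those of the injective linear map by at most
half of its lower bound. -/
theorem exists_biLipschitz_near [FiniteDimensional ℝ E] {h : E → F} {x₀ : E}
    (hh : ContDiffAt ℝ 1 h x₀) (hinj : Injective (fderiv ℝ h x₀)) :
    ∃ c : ℝ, 1 ≤ c ∧ ∃ V ∈ 𝓝 x₀, ∀ x ∈ V, ∀ y ∈ V,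
      dist (h x) (h y) ≤ c * dist x y ∧ dist x y ≤ c * dist (h x) (h y) := by
  obtain ⟨a, ha, haT⟩ := exists_norm_le_mul_norm_of_injective _ hinj
  obtain ⟨L, U, hU, hL⟩ := hh.exists_lipschitzOnWith
  have hstrict := hh.hasStrictFDerivAt (by norm_num)
  obtain ⟨V, hV, hVa⟩ := hstrict.approximates_deriv_on_nhds
    (c := (a / 2).toNNReal) (Or.inr (Real.toNNReal_pos.2 (half_pos ha)))
  refine ⟨max 1 (max L (2 / a)), le_max_left _ _, U ∩ V, Filter.inter_mem hU hV, ?_⟩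
  rintro x ⟨hxU, hxV⟩ y ⟨hyU, hyV⟩
  constructor
  · exact (hL.dist_le_mul x hxU y hyU).trans
      (mul_le_mul_of_nonneg_right ((le_max_left _ _).trans (le_max_right _ _)) dist_nonneg)
  · have h1 : ‖h x - h y - fderiv ℝ h x₀ (x - y)‖ ≤ a / 2 * ‖x - y‖ := by
      have := hVa x hxV y hyV
      rwa [Real.coe_toNNReal _ (half_pos ha).le] at this
    have h2 := haT (x - y)
    have h3 : ‖fderiv ℝ h x₀ (x - y)‖ ≤ ‖h x - h y‖ + ‖h x - h y - fderiv ℝ h x₀ (x - y)‖ := by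
      have := norm_sub_le (h x - h y) (h x - h y - fderiv ℝ h x₀ (x - y))
      simpa using this
    have h4 : dist x y ≤ 2 / a * dist (h x) (h y) := by
      rw [dist_eq_norm, dist_eq_norm, div_mul_eq_mul_div, le_div_iff₀ ha]
      linarith
    exact h4.trans
      (mul_le_mul_of_nonneg_right ((le_max_right _ _).trans (le_max_right _ _)) dist_nonneg)

/-- A local `C¹` immersion which is injective is bi-Lipschitz on compact sets. -/
theorem exists_biLipschitz_on_compact [FiniteDimensional ℝ E] {h : E → F} {Q : Set E}
    (hQ : IsCompact Q) (hh : ∀ x ∈ Q, ContDiffAt ℝ 1 h x)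
    (hinj : ∀ x ∈ Q, Injective (fderiv ℝ h x)) (hQinj : InjOn h Q) :
    ∃ c : ℝ, 1 ≤ c ∧ ∀ x ∈ Q, ∀ y ∈ Q,
      dist (h x) (h y) ≤ c * dist x y ∧ dist x y ≤ c * dist (h x) (h y) := by
  -- The property passes to subsets and finite unions, so compactness of `Q ×ˢ Q` reduces it to
  -- neighbourhoods of single pairs: diagonal pairs use the immersion, and off the diagonal both
  -- distances lie between positive constants.
  let P : Set (E × E) → Prop := fun s => ∃ c : ℝ, 1 ≤ c ∧ ∀ z ∈ s, z ∈ Q ×ˢ Q →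
      dist (h z.1) (h z.2) ≤ c * dist z.1 z.2 ∧ dist z.1 z.2 ≤ c * dist (h z.1) (h z.2)
  suffices H : P (Q ×ˢ Q) by
    obtain ⟨c, hc, H⟩ := H
    exact ⟨c, hc, fun x hx y hy => H (x, y) ⟨hx, hy⟩ ⟨hx, hy⟩⟩
  refine (hQ.prod hQ).induction_on (p := P) ⟨1, le_rfl, by simp⟩ ?_ ?_ ?_
  · rintro s t hst ⟨c, hc, H⟩
    exact ⟨c, hc, fun z hz => H z (hst hz)⟩
  · rintro s t ⟨c, hc, H⟩ ⟨c', hc', H'⟩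
    refine ⟨max c c', hc.trans (le_max_left _ _), fun z hz hzQ => ?_⟩
    rcases hz with hz | hz
    · exact ⟨(H z hz hzQ).1.trans (by gcongr; exact le_max_left _ _),
        (H z hz hzQ).2.trans (by gcongr; exact le_max_left _ _)⟩
    · exact ⟨(H' z hz hzQ).1.trans (by gcongr; exact le_max_right _ _),
        (H' z hz hzQ).2.trans (by gcongr; exact le_max_right _ _)⟩
  · rintro ⟨x, y⟩ ⟨hx, hy⟩
    rcases eq_or_ne x y with rfl | hxy
    · obtain ⟨c, hc, V, hV, H⟩ := exists_biLipschitz_near (hh x hx) (hinj x hx)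
      exact ⟨V ×ˢ V, mem_nhdsWithin_of_mem_nhds (prod_mem_nhds hV hV), c, hc,
        fun z hz _ => H _ hz.1 _ hz.2⟩
    · have hd : 0 < dist x y := dist_pos.2 hxy
      have hdh : 0 < dist (h x) (h y) := dist_pos.2 fun he => hxy (hQinj hx hy he)
      have hcx : ContinuousAt (fun z : E × E => h z.1) (x, y) :=
        ContinuousAt.comp (f := Prod.fst) (hh x hx).continuousAt continuousAt_fst
      have hcy : ContinuousAt (fun z : E × E => h z.2) (x, y) :=
        ContinuousAt.comp (f := Prod.snd) (hh y hy).continuousAt continuousAt_snd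
      have c1 : ContinuousAt (fun z : E × E => dist (h z.1) (h z.2)) (x, y) := hcx.dist hcy
      have c2 : ContinuousAt (fun z : E × E => dist z.1 z.2) (x, y) :=
        continuousAt_fst.dist continuousAt_snd
      set m := min (dist x y / 2) (dist (h x) (h y) / 2)
      set m' := max (dist x y + 1) (dist (h x) (h y) + 1)
      have hm : 0 < m := by positivity
      have hm' : 0 < m' := lt_max_of_lt_left (by positivity)
      have hev : ∀ᶠ z in 𝓝 (x, y), m ≤ dist z.1 z.2 ∧ dist z.1 z.2 ≤ m' ∧
          m ≤ dist (h z.1) (h z.2) ∧ dist (h z.1) (h z.2) ≤ m' := by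
        filter_upwards [c2 (Ioi_mem_nhds (half_lt_self hd)), c2 (Iio_mem_nhds (lt_add_one _)),
          c1 (Ioi_mem_nhds (half_lt_self hdh)), c1 (Iio_mem_nhds (lt_add_one _))]
          with z h1 h2 h3 h4
        exact ⟨(min_le_left _ _).trans (le_of_lt h1), (le_of_lt h2).trans (le_max_left _ _),
          (min_le_right _ _).trans (le_of_lt h3), (le_of_lt h4).trans (le_max_right _ _)⟩
      refine ⟨_, mem_nhdsWithin_of_mem_nhds hev, max 1 (m' / m), le_max_left _ _, ?_⟩
      rintro z ⟨h1, h2, h3, h4⟩ -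
      have hratio : m' ≤ max 1 (m' / m) * m := by
        calc m' = m' / m * m := by field_simp
          _ ≤ _ := mul_le_mul_of_nonneg_right (le_max_right _ _) hm.le
      have hpos : 0 ≤ max 1 (m' / m) := by positivity
      exact ⟨h4.trans (hratio.trans (mul_le_mul_of_nonneg_left h1 hpos)),
        h2.trans (hratio.trans (mul_le_mul_of_nonneg_left h3 hpos))⟩

/-- A bounded left inverse of an injective linear map into an inner product space. -/
theorem exists_leftInverse_of_norm_le {V H : Type*} [NormedAddCommGroup V] [NormedSpace ℝ V]
    [NormedAddCommGroup H] [InnerProductSpace ℝ H] [FiniteDimensional ℝ H] (T : V →ₗ[ℝ] H) {c : ℝ}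
    (hc : 0 ≤ c) (hT : ∀ v, ‖v‖ ≤ c * ‖T v‖) :
    ∃ P : H →ₗ[ℝ] V, (∀ v, P (T v) = v) ∧ ∀ w, ‖P w‖ ≤ c * ‖w‖ := by
  have hinj : Injective T := (injective_iff_map_eq_zero T).2 fun v hv => by
    have := hT v
    rw [hv, norm_zero, mul_zero] at this
    exact norm_le_zero_iff.1 this
  let e := LinearEquiv.ofInjective T hinj
  let pr := (LinearMap.range T).orthogonalProjectionOnto
  refine ⟨e.symm.toLinearMap ∘ₗ pr.toLinearMap, fun v => ?_, fun w => ?_⟩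
  · have : pr (T v) = e v := by
      have := (LinearMap.range T).orthogonalProjectionOnto_mem_subspace_eq_self (e v)
      exact this
    change e.symm (pr (T v)) = v
    rw [this, e.symm_apply_apply]
  · change ‖e.symm (pr w)‖ ≤ _
    refine (hT _).trans ?_
    have : T (e.symm (pr w)) = (pr w : H) := congrArg Subtype.val (e.apply_symm_apply (pr w))
    rw [this]
    exact mul_le_mul_of_nonneg_left ((LinearMap.range T).norm_orthogonalProjectionOnto_apply_le w) hc

end Taylor

/-! ### Tangent vectors approximating chords -/

section TangentApproximation

variable {d n : ℕ} {M : Type*} [TopologicalSpace M] [ChartedSpace (EuclideanSpace ℝ (Fin d)) M]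

/-- The derivative of a map into a Euclidean space, with values in that space. -/
noncomputable def ambientDeriv (g : M → EuclideanSpace ℝ (Fin n)) (p : M) :
    TangentSpace (𝓡 d) p →L[ℝ] EuclideanSpace ℝ (Fin n) :=
  mfderiv (𝓡 d) 𝓘(ℝ, EuclideanSpace ℝ (Fin n)) g p

theorem contDiffAt_writtenInExtChartAt {f : M → M} (hf : ContMDiff (𝓡 d) (𝓡 d) 1 f) (x₀ : M) :
    ContDiffAt ℝ 1 (writtenInExtChartAt (𝓡 d) (𝓡 d) x₀ f) (extChartAt (𝓡 d) x₀ x₀) := by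
  have := (contMDiffAt_iff.1 (hf.contMDiffAt (x := x₀))).2
  rwa [ModelWithCorners.range_eq_univ, contDiffWithinAt_univ] at this

section

variable [IsManifold (𝓡 d) ∞ M]

theorem contDiffAt_comp_extChartAt_symm {k : WithTop ℕ∞} {g : M → EuclideanSpace ℝ (Fin n)}
    (hk : k ≤ ∞)
    (hg : ContMDiff (𝓡 d) 𝓘(ℝ, EuclideanSpace ℝ (Fin n)) k g) (x₀ : M) :
    ContDiffAt ℝ k (g ∘ (extChartAt (𝓡 d) x₀).symm) (extChartAt (𝓡 d) x₀ x₀) := by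
  have h1 : ContMDiffAt 𝓘(ℝ, EuclideanSpace ℝ (Fin d)) (𝓡 d) k (extChartAt (𝓡 d) x₀).symm
      (extChartAt (𝓡 d) x₀ x₀) :=
    ((contMDiffOn_extChartAt_symm (I := 𝓡 d) (n := ∞) x₀).of_le hk).contMDiffAt (extChartAt_target_mem_nhds (I := 𝓡 d) x₀)
  exact (hg.contMDiffAt.comp _ h1).contDiffAt

/-- Near the point, `e ∘ f` in the source chart is `f` read in charts followed by the smooth map `e`
read in the target chart. -/
theorem hasTaylorBoundAt_comp_extChartAt_symm {f : M → M} {θ : ℝ≥0} (hθ : θ ≤ 1)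
    (hf : IsC1Holder d θ f) {e : M → EuclideanSpace ℝ (Fin n)}
    (he : ContMDiff (𝓡 d) 𝓘(ℝ, EuclideanSpace ℝ (Fin n)) ∞ e) (x₀ : M) :
    HasTaylorBoundAt θ ((e ∘ f) ∘ (extChartAt (𝓡 d) x₀).symm) (extChartAt (𝓡 d) x₀ x₀) := by
  obtain ⟨C, U, hU, hC⟩ := hf.2 x₀
  have hF := contDiffAt_writtenInExtChartAt hf.1 x₀
  have hFT : HasTaylorBoundAt θ (writtenInExtChartAt (𝓡 d) (𝓡 d) x₀ f) (extChartAt (𝓡 d) x₀ x₀) :=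
    HasTaylorBoundAt.of_holderOnWith hU hC
      ((hF.eventually (by simp)).mono fun x hx => hx.differentiableAt (by simp))
  have hval : writtenInExtChartAt (𝓡 d) (𝓡 d) x₀ f (extChartAt (𝓡 d) x₀ x₀) =
      extChartAt (𝓡 d) (f x₀) (f x₀) := by
    simp only [writtenInExtChartAt, comp_apply, extChartAt_to_inv]
  have he2 : ContDiffAt ℝ 2 (e ∘ (extChartAt (𝓡 d) (f x₀)).symm)
      (writtenInExtChartAt (𝓡 d) (𝓡 d) x₀ f (extChartAt (𝓡 d) x₀ x₀)) := by
    rw [hval]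
    exact (contDiffAt_comp_extChartAt_symm le_rfl he (f x₀)).of_le ENat.LEInfty.out
  refine (HasTaylorBoundAt.comp (by exact_mod_cast hθ) he2 hF hFT).congr ?_
  have hcont : ContinuousAt (f ∘ (extChartAt (𝓡 d) x₀).symm) (extChartAt (𝓡 d) x₀ x₀) := by
    refine ContinuousAt.comp ?_ (continuousAt_extChartAt_symm x₀)
    exact hf.1.continuous.continuousAt
  have hmem : (extChartAt (𝓡 d) (f x₀)).source ∈
      𝓝 ((f ∘ (extChartAt (𝓡 d) x₀).symm) (extChartAt (𝓡 d) x₀ x₀)) := by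
    simp only [comp_apply, extChartAt_to_inv]
    exact extChartAt_source_mem_nhds (f x₀)
  filter_upwards [hcont hmem] with x hx
  simp only [writtenInExtChartAt, comp_apply]
  rw [mem_preimage, comp_apply] at hx
  rw [(extChartAt (𝓡 d) (f x₀)).left_inv hx]

end

variable [Bundle.RiemannianBundle (fun x : M => TangentSpace (𝓡 d) x)]

/-- Between nearby points, `e` and `e ∘ f` are approximated by their derivatives at `p`, along a
tangent vector whose Riemannian length is comparable to the distance. -/
def HasTangentApprox (d : ℕ) {n : ℕ} {M : Type*} [TopologicalSpace M]
    [ChartedSpace (EuclideanSpace ℝ (Fin d)) M]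
    [Bundle.RiemannianBundle (fun x : M => TangentSpace (𝓡 d) x)]
    (θ : ℝ) (f : M → M)
    (e : M → EuclideanSpace ℝ (Fin n)) (A : ℝ) (p q : M) : Prop :=
  0 ≤ A ∧ (∀ w : TangentSpace (𝓡 d) p, ‖w‖ ≤ A * ‖ambientDeriv e p w‖) ∧
  (∀ w : TangentSpace (𝓡 d) p, ‖ambientDeriv (e ∘ f) p w‖ ≤ A * ‖w‖) ∧
  ∃ w : TangentSpace (𝓡 d) p, ‖w‖ ≤ A * ‖e q - e p‖ ∧ ‖e q - e p‖ ≤ A * ‖w‖ ∧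
    ‖e q - e p - ambientDeriv e p w‖ ≤ A * ‖w‖ * ‖w‖ ∧
    ‖e (f q) - e (f p) - ambientDeriv (e ∘ f) p w‖ ≤ A * ‖w‖ ^ θ * ‖w‖

theorem HasTangentApprox.mono {θ A A' : ℝ} {f : M → M} {e : M → EuclideanSpace ℝ (Fin n)} {p q : M}
    (h : HasTangentApprox d θ f e A p q) (hA : A ≤ A') : HasTangentApprox d θ f e A' p q := by
  obtain ⟨h0, h1, h2, w, h3, h4, h5, h6⟩ := h
  refine ⟨h0.trans hA, fun w => (h1 w).trans ?_, fun w => (h2 w).trans ?_, w, h3.trans ?_,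
    h4.trans ?_, h5.trans ?_, h6.trans ?_⟩ <;> gcongr

variable [IsManifold (𝓡 d) ∞ M]
  [IsContMDiffRiemannianBundle (𝓡 d) ∞ (EuclideanSpace ℝ (Fin d))
    (fun x : M => TangentSpace (𝓡 d) x)]

theorem isContinuousRiemannianBundle_tangentSpace :
    IsContinuousRiemannianBundle (EuclideanSpace ℝ (Fin d))
      (fun x : M => TangentSpace (𝓡 d) x) := by
  obtain ⟨g, hg, h⟩ := IsContMDiffRiemannianBundle.exists_contMDiff (IB := 𝓡 d) (n := ∞)
    (F := EuclideanSpace ℝ (Fin d)) (E := fun x : M => TangentSpace (𝓡 d) x)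
  exact ⟨g, hg.continuous, h⟩

/-- The map `S` is the inverse of the tangent trivialization at `x₀`. Continuity of the Riemannian
metric makes its norm and that of its inverse locally bounded, which lets chart estimates be stated
with Riemannian norms. -/
theorem exists_tangent_chart (x₀ : M) : ∃ C : ℝ, 1 ≤ C ∧ ∀ᶠ p in 𝓝 x₀,
    ∃ S : EuclideanSpace ℝ (Fin d) →L[ℝ] TangentSpace (𝓡 d) p, Surjective S ∧
      (∀ u, ‖S u‖ ≤ C * ‖u‖ ∧ ‖u‖ ≤ C * ‖S u‖) ∧
      ∀ {n : ℕ} (g : M → EuclideanSpace ℝ (Fin n)),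
        MDifferentiableAt (𝓡 d) 𝓘(ℝ, EuclideanSpace ℝ (Fin n)) g p →
        ∀ u, ambientDeriv g p (S u) =
          fderiv ℝ (g ∘ (extChartAt (𝓡 d) x₀).symm) (extChartAt (𝓡 d) x₀ p) u := by
  have := isContinuousRiemannianBundle_tangentSpace (d := d) (M := M)
  have e1 := eventually_norm_trivializationAt_lt (EuclideanSpace ℝ (Fin d))
    (fun x : M => TangentSpace (𝓡 d) x) x₀
  have e2 := eventually_norm_symmL_trivializationAt_lt (EuclideanSpace ℝ (Fin d))
    (fun x : M => TangentSpace (𝓡 d) x) x₀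
  obtain ⟨C₁, hC₁, h₁⟩ := e1
  obtain ⟨C₂, hC₂, h₂⟩ := e2
  refine ⟨max 1 (max C₁ C₂), le_max_left _ _, ?_⟩
  filter_upwards [h₁, h₂, chart_source_mem_nhds (EuclideanSpace ℝ (Fin d)) x₀] with p hp1 hp2 hp
  set t := trivializationAt (EuclideanSpace ℝ (Fin d)) (TangentSpace (𝓡 d) : M → Type _) x₀ with ht
  have hpb : p ∈ t.baseSet := by simpa [ht] using hp
  have hS : ∀ u, t.continuousLinearMapAt ℝ p (t.symmL ℝ p u) = u := fun u =>
    t.continuousLinearMapAt_symmL (R := ℝ) hpb u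
  have hS' : ∀ w, t.symmL ℝ p (t.continuousLinearMapAt ℝ p w) = w := fun u =>
    t.symmL_continuousLinearMapAt (R := ℝ) hpb u
  refine ⟨t.symmL ℝ p, fun w => ⟨_, hS' w⟩, fun u => ⟨?_, ?_⟩, ?_⟩
  · exact (t.symmL ℝ p).le_of_opNorm_le
      (hp2.le.trans ((le_max_right _ _).trans (le_max_right _ _))) u
  · have := (t.continuousLinearMapAt ℝ p).le_of_opNorm_le
      (hp1.le.trans ((le_max_left C₁ C₂).trans (le_max_right 1 _))) (t.symmL ℝ p u)
    rwa [hS] at this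
  · intro n g hg u
    have hps : p ∈ (extChartAt (𝓡 d) x₀).source := by rwa [extChartAt_source]
    have hinv : (extChartAt (𝓡 d) x₀).symm (extChartAt (𝓡 d) x₀ p) = p :=
      (extChartAt (𝓡 d) x₀).left_inv hps
    have hsymm : MDifferentiableAt 𝓘(ℝ, EuclideanSpace ℝ (Fin d)) (𝓡 d)
        (extChartAt (𝓡 d) x₀).symm (extChartAt (𝓡 d) x₀ p) := by
      have := mdifferentiableWithinAt_extChartAt_symm (I := 𝓡 d)
        ((extChartAt (𝓡 d) x₀).map_source hps)
      rwa [ModelWithCorners.range_eq_univ, mdifferentiableWithinAt_univ] at this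
    have hcomp : MDifferentiableAt 𝓘(ℝ, EuclideanSpace ℝ (Fin d)) 𝓘(ℝ, EuclideanSpace ℝ (Fin n))
        (g ∘ (extChartAt (𝓡 d) x₀).symm) (extChartAt (𝓡 d) x₀ p) :=
      MDifferentiableAt.comp _ (by rwa [hinv]) hsymm
    have heq : g =ᶠ[𝓝 p] (g ∘ (extChartAt (𝓡 d) x₀).symm) ∘ extChartAt (𝓡 d) x₀ := by
      filter_upwards [extChartAt_source_mem_nhds' (I := 𝓡 d) hps] with z hz
      simp only [comp_apply, (extChartAt (𝓡 d) x₀).left_inv hz]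
    have hd : ambientDeriv g p = (fderiv ℝ (g ∘ (extChartAt (𝓡 d) x₀).symm)
        (extChartAt (𝓡 d) x₀ p)).comp (t.continuousLinearMapAt ℝ p) := by
      rw [TangentBundle.continuousLinearMapAt_trivializationAt hp, ← mfderiv_eq_fderiv]
      unfold ambientDeriv
      rw [heq.mfderiv_eq]
      exact mfderiv_comp p hcomp (mdifferentiableAt_extChartAt hp)
    rw [hd, ContinuousLinearMap.comp_apply, hS]

/-- The tangent vector is the coordinate difference of `q` and `p`, transported by `S`; the
estimates are then Taylor and bi-Lipschitz bounds in the chart. -/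
theorem exists_hasTangentApprox_near {f : M → M} {θ : ℝ≥0} (hθ : θ ≤ 1)
    (hf : IsC1Holder d θ f) {e : M → EuclideanSpace ℝ (Fin n)}
    (he : ContMDiff (𝓡 d) 𝓘(ℝ, EuclideanSpace ℝ (Fin n)) ∞ e)
    (hinj : ∀ x, Injective (mfderiv (𝓡 d) 𝓘(ℝ, EuclideanSpace ℝ (Fin n)) e x)) (x₀ : M) :
    ∃ A : ℝ, ∃ V ∈ 𝓝 x₀, ∀ p ∈ V, ∀ q ∈ V, HasTangentApprox d θ f e A p q := by
  set φ := extChartAt (𝓡 d) x₀ with hφ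
  obtain ⟨C, hC, hS⟩ := exists_tangent_chart (d := d) x₀
  have hef : ContMDiff (𝓡 d) 𝓘(ℝ, EuclideanSpace ℝ (Fin n)) 1 (e ∘ f) :=
    (he.of_le (by exact_mod_cast le_top)).comp hf.1
  have hed : ∀ p, MDifferentiableAt (𝓡 d) 𝓘(ℝ, EuclideanSpace ℝ (Fin n)) e p := fun p =>
    he.mdifferentiableAt (by simp)
  have hefd : ∀ p, MDifferentiableAt (𝓡 d) 𝓘(ℝ, EuclideanSpace ℝ (Fin n)) (e ∘ f) p := fun p =>
    hef.mdifferentiableAt (by simp)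
  have hh : ContDiffAt ℝ 2 (e ∘ φ.symm) (φ x₀) :=
    (contDiffAt_comp_extChartAt_symm le_rfl he x₀).of_le ENat.LEInfty.out
  have hh1 : ContDiffAt ℝ 1 (e ∘ φ.symm) (φ x₀) := hh.of_le (by norm_num)
  have hk : ContDiffAt ℝ 1 ((e ∘ f) ∘ φ.symm) (φ x₀) :=
    contDiffAt_comp_extChartAt_symm (by exact_mod_cast le_top) hef x₀
  have hhinj : Injective (fderiv ℝ (e ∘ φ.symm) (φ x₀)) := by
    obtain ⟨S, -, hSn, hSd⟩ := hS.self_of_nhds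
    refine (injective_iff_map_eq_zero _).2 fun u hu => ?_
    have h1 := hSd e (hed x₀) u
    rw [hu] at h1
    have h2 : S u = 0 := hinj x₀ (h1.trans (map_zero (ambientDeriv (d := d) e x₀)).symm)
    have h3 := (hSn u).2
    rw [h2, norm_zero, mul_zero] at h3
    exact norm_le_zero_iff.1 h3
  obtain ⟨a, ha, hE1⟩ := eventually_mul_norm_le_norm_fderiv hh1 hhinj
  obtain ⟨A₂, hA₂, V₂, hV₂, hE2⟩ := HasTaylorBoundAt.of_contDiffAt hh
  obtain ⟨A₃, hA₃, V₃, hV₃, hE3⟩ : HasTaylorBoundAt θ ((e ∘ f) ∘ φ.symm) (φ x₀) :=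
    hasTaylorBoundAt_comp_extChartAt_symm hθ hf he x₀
  obtain ⟨A₄, hA₄, hE4⟩ := eventually_norm_fderiv_le hk
  obtain ⟨c, hc, V₅, hV₅, hE5⟩ := exists_biLipschitz_near hh1 hhinj
  have hφc : ContinuousAt φ x₀ := continuousAt_extChartAt x₀
  have hC0 : 0 ≤ C := by linarith
  have hc0 : 0 ≤ c := by linarith
  set A := max (max (C / a) (A₄ * C)) (max (C * c) (max (A₂ * (C * C)) (A₃ * (C * C)))) with hA
  have b1 : C / a ≤ A := (le_max_left _ _).trans (le_max_left _ _)
  have b2 : A₄ * C ≤ A := (le_max_right _ _).trans (le_max_left _ _)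
  have b3 : C * c ≤ A := (le_max_left _ _).trans (le_max_right _ _)
  have b4 : A₂ * (C * C) ≤ A :=
    ((le_max_left _ _).trans (le_max_right _ _)).trans (le_max_right _ _)
  have b5 : A₃ * (C * C) ≤ A :=
    ((le_max_right _ _).trans (le_max_right _ _)).trans (le_max_right _ _)
  refine ⟨A, _, (((hS.and (extChartAt_source_mem_nhds (I := 𝓡 d) x₀)).and
    ((hφc.eventually hE1).and (hφc.eventually hE4))).and
    ((hφc.eventually_mem hV₂).and ((hφc.eventually_mem hV₃).and (hφc.eventually_mem hV₅))) :
      ∀ᶠ p in 𝓝 x₀, _), ?_⟩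
  rintro p ⟨⟨⟨⟨S, hSs, hSn, hSd⟩, hps⟩, hp1, hp4⟩, hp2, hp3, hp5⟩
    q ⟨⟨⟨-, hqs⟩, -⟩, hq2, hq3, hq5⟩
  have hinvp : φ.symm (φ p) = p := φ.left_inv hps
  have hinvq : φ.symm (φ q) = q := φ.left_inv hqs
  have hde := hSd e (hed p)
  have hdef := hSd (e ∘ f) (hefd p)
  have t2 := hE2 _ hp2 _ hq2
  have t3 := hE3 _ hp3 _ hq3
  have t5 := hE5 _ hq5 _ hp5
  simp only [comp_apply, hinvp, hinvq, Real.rpow_one, dist_eq_norm] at t2 t3 t5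
  set u := φ q - φ p with hu
  have hu1 : ‖u‖ ≤ C * ‖S u‖ := (hSn u).2
  refine ⟨by positivity, fun w => ?_, fun w => ?_, S u, ?_, ?_, ?_, ?_⟩
  · obtain ⟨v, rfl⟩ := hSs w
    rw [hde]
    have h1 := hp1 v
    calc ‖S v‖ ≤ C * ‖v‖ := (hSn v).1
      _ = C / a * (a * ‖v‖) := by field_simp
      _ ≤ A * ‖fderiv ℝ (e ∘ φ.symm) (φ p) v‖ := by gcongr
  · obtain ⟨v, rfl⟩ := hSs w
    rw [hdef]
    calc ‖fderiv ℝ ((e ∘ f) ∘ φ.symm) (φ p) v‖ ≤ A₄ * ‖v‖ :=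
          ContinuousLinearMap.le_of_opNorm_le _ hp4 v
      _ ≤ A₄ * (C * ‖S v‖) := by gcongr; exact (hSn v).2
      _ = A₄ * C * ‖S v‖ := by ring
      _ ≤ A * ‖S v‖ := by gcongr
  · calc ‖S u‖ ≤ C * ‖u‖ := (hSn u).1
      _ ≤ C * (c * ‖e q - e p‖) := by gcongr; exact t5.2
      _ = C * c * ‖e q - e p‖ := by ring
      _ ≤ _ := by gcongr
  · calc ‖e q - e p‖ ≤ c * ‖u‖ := t5.1
      _ ≤ c * (C * ‖S u‖) := by gcongr
      _ = C * c * ‖S u‖ := by ring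
      _ ≤ _ := by gcongr
  · rw [hde]
    calc _ ≤ A₂ * ‖u‖ * ‖u‖ := t2
      _ ≤ A₂ * (C * ‖S u‖) * (C * ‖S u‖) := by gcongr
      _ = A₂ * (C * C) * (‖S u‖ * ‖S u‖) := by ring
      _ ≤ A * (‖S u‖ * ‖S u‖) := by gcongr
      _ = _ := by ring
  · rw [hdef]
    have hpow : ‖u‖ ^ (θ : ℝ) ≤ C * ‖S u‖ ^ (θ : ℝ) :=
      calc ‖u‖ ^ (θ : ℝ) ≤ (C * ‖S u‖) ^ (θ : ℝ) := by gcongr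
        _ = C ^ (θ : ℝ) * ‖S u‖ ^ (θ : ℝ) := Real.mul_rpow hC0 (norm_nonneg _)
        _ ≤ C * ‖S u‖ ^ (θ : ℝ) := by
          gcongr
          simpa using Real.rpow_le_rpow_of_exponent_le hC (show (θ : ℝ) ≤ 1 by exact_mod_cast hθ)
    calc _ ≤ A₃ * ‖u‖ ^ (θ : ℝ) * ‖u‖ := t3
      _ ≤ A₃ * (C * ‖S u‖ ^ (θ : ℝ)) * (C * ‖S u‖) := by gcongr
      _ = A₃ * (C * C) * (‖S u‖ ^ (θ : ℝ) * ‖S u‖) := by ring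
      _ ≤ A * (‖S u‖ ^ (θ : ℝ) * ‖S u‖) := by gcongr
      _ = _ := by ring

end TangentApproximation

/-- A finite subcover gives a common constant, and its Lebesgue number puts nearby points into one
member of the cover. -/
theorem exists_uniform_of_locally {M : Type*} [PseudoMetricSpace M] [CompactSpace M]
    {P : ℝ → M → M → Prop} (hmono : ∀ A A' p q, A ≤ A' → P A p q → P A' p q)
    (H : ∀ x, ∃ A : ℝ, ∃ V ∈ 𝓝 x, ∀ p ∈ V, ∀ q ∈ V, P A p q) :
    ∃ A : ℝ, ∃ r > 0, ∀ p q, dist p q ≤ r → P A p q := by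
  choose A V hV hP using H
  obtain ⟨t, -, ht⟩ := isCompact_univ.elim_nhds_subcover (fun x => interior (V x))
    fun x _ => interior_mem_nhds.2 (hV x)
  obtain ⟨A₀, hA₀⟩ := (t.image fun x => A x).exists_le
  obtain ⟨r, hr, hleb⟩ := lebesgue_number_lemma_of_metric (s := (univ : Set M))
    (c := fun x : t => interior (V x)) isCompact_univ (fun x => isOpen_interior)
    (by
      intro x hx
      obtain ⟨y, hy, hxy⟩ := mem_iUnion₂.1 (ht hx)
      exact mem_iUnion.2 ⟨⟨y, hy⟩, hxy⟩)
  refine ⟨A₀, r / 2, half_pos hr, fun p q hpq => ?_⟩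
  obtain ⟨x, hx⟩ := hleb p (mem_univ p)
  refine hmono _ _ _ _ (hA₀ _ (Finset.mem_image_of_mem _ x.2)) (hP _ p ?_ q ?_)
  · exact interior_subset (hx (Metric.mem_ball_self hr))
  · refine interior_subset (hx ?_)
    rw [Metric.mem_ball, dist_comm]
    linarith

/-! ### From conformal expanding maps to bounded distortion -/

section ConformalExpanding

variable {d : ℕ} {M : Type*} [MetricSpace M]
  [ChartedSpace (EuclideanSpace ℝ (Fin d)) M]
  [Bundle.RiemannianBundle (fun x : M => TangentSpace (𝓡 d) x)]

theorem norm_mfderiv_iterate {f : M → M} (hf : ContMDiff (𝓡 d) (𝓡 d) 1 f) {lam : M → ℝ}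
    (hlam : ∀ (p : M) (w : TangentSpace (𝓡 d) p), ‖mfderiv (𝓡 d) (𝓡 d) f p w‖ = lam p * ‖w‖)
    (k : ℕ) (p : M) (w : TangentSpace (𝓡 d) p) :
    ‖mfderiv (𝓡 d) (𝓡 d) f^[k] p w‖ = cocycleProd f lam k p * ‖w‖ := by
  have hfd : ∀ p, MDifferentiableAt (𝓡 d) (𝓡 d) f p := fun p => hf.mdifferentiableAt (by simp)
  have hkd : ∀ k p, MDifferentiableAt (𝓡 d) (𝓡 d) f^[k] p := by
    intro k
    induction k with
    | zero => exact fun p => mdifferentiableAt_id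
    | succ k ih =>
      intro p
      rw [iterate_succ']
      exact (hfd _).comp p (ih p)
  induction k with
  | zero =>
    rw [cocycleProd_zero, one_mul, iterate_zero, mfderiv_id]
    rfl
  | succ k ih =>
    rw [cocycleProd_succ, mul_comm (cocycleProd f lam k p), mul_assoc, ← ih,
      ← hlam (f^[k] p), iterate_succ', mfderiv_comp p (hfd _) (hkd k p)]
    rfl

/-- The quasi-distance of two points: the Riemannian length at `p` of a linear projection of the
chord from `e p` to `e q` to the tangent space. -/
theorem exists_quasiDist {n : ℕ} {f : M → M} {θ : ℝ} (hθ0 : 0 < θ) (hθ : θ ≤ 1)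
    (hf : ContMDiff (𝓡 d) (𝓡 d) 1 f) {e : M → EuclideanSpace ℝ (Fin n)}
    (he : ContMDiff (𝓡 d) 𝓘(ℝ, EuclideanSpace ℝ (Fin n)) ∞ e)
    (hdist : ∀ p q, dist p q = dist (e p) (e q)) {A r : ℝ} (hr : 0 < r)
    (happ : ∀ p q, dist p q ≤ r → HasTangentApprox d θ f e A p q) {lam : M → ℝ} {l : ℝ}
    (hl : 0 < l) (hlaml : ∀ p, l ≤ lam p)
    (hlam : ∀ (p : M) (w : TangentSpace (𝓡 d) p), ‖mfderiv (𝓡 d) (𝓡 d) f p w‖ = lam p * ‖w‖)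
    {L : ℝ} (hL : ∀ p, lam p ≤ L) :
    ∃ (D : M → M → ℝ) (r' A' c : ℝ), 0 < r' ∧ 0 ≤ A' ∧ 1 ≤ c ∧
      (∀ p q, dist p q ≤ r' →
        |D (f p) (f q) - lam p * D p q| ≤ A' * D p q ^ θ * (lam p * D p q)) ∧
      ∀ p q, dist p q ≤ r' → dist p q ≤ c * D p q ∧ D p q ≤ c * dist p q := by
  rcases isEmpty_or_nonempty M with hM | ⟨⟨p₀⟩⟩
  · exact ⟨fun _ _ => 0, 1, 0, 1, one_pos, le_rfl, le_rfl, fun p => hM.elim p, fun p => hM.elim p⟩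
  have hself : ∀ p, HasTangentApprox d θ f e A p p := fun p => happ p p (by simpa using hr.le)
  have hA : 0 ≤ A := (hself p₀).1
  have hL0 : 0 < L := hl.trans_le ((hlaml p₀).trans (hL p₀))
  -- No regularity of `P p` in `p` is needed, only the uniform bound `A` on its norm.
  choose P hPe hPn using fun p : M =>
    exists_leftInverse_of_norm_le (ambientDeriv (d := d) e p).toLinearMap hA (hself p).2.1
  have hchain : ∀ (p : M) (w : TangentSpace (𝓡 d) p),
      ambientDeriv (e ∘ f) p w = ambientDeriv e (f p) (mfderiv (𝓡 d) (𝓡 d) f p w) := by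
    intro p w
    have := mfderiv_comp (I := 𝓡 d) (I' := 𝓡 d) (I'' := 𝓘(ℝ, EuclideanSpace ℝ (Fin n))) p
      (he.mdifferentiableAt (by simp) (x := f p)) (hf.mdifferentiableAt (by simp) (x := p))
    unfold ambientDeriv
    rw [this]
    rfl
  -- The term `2 * A ^ 3` gives `A ^ 2 * ‖w‖ ≤ 1 / 2`, hence comparability of `D p q` and `‖w‖`
  -- within a factor two; the term `A` gives `‖w‖ ≤ 1`.
  set r' := min r (1 / (2 * A ^ 3 + A + 1)) with hr'
  have hr'0 : 0 < r' := by positivity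
  set B := A * A with hB
  have hB0 : 0 ≤ B := by positivity
  refine ⟨fun p q => ‖P p (e q - e p)‖, r', 4 * (B * (1 + L)) / l, 2 * A + 1, hr'0,
    by positivity, by linarith, ?_, ?_⟩
  all_goals
    intro p q hpq
    obtain ⟨-, h1, h2, w, hw1, hw2, hw3, hw4⟩ := happ p q (hpq.trans (min_le_left _ _))
    have hde : dist p q = ‖e q - e p‖ := by rw [hdist, dist_comm, dist_eq_norm]
    have hdr : ‖e q - e p‖ * (2 * A ^ 3 + A + 1) ≤ 1 := by
      rw [← hde, ← le_div_iff₀ (by positivity)]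
      exact hpq.trans (min_le_right _ _)
    have hd0 := norm_nonneg (e q - e p)
    have hw0 := norm_nonneg w
    have hBw : B * ‖w‖ ≤ 1 / 2 := by
      have e1 := mul_le_mul_of_nonneg_left hw1 hB0
      have e2 : 0 ≤ ‖e q - e p‖ * (A + 1) := by positivity
      linear_combination e1 + 1 / 2 * hdr + 1 / 2 * e2
    have hw_le : ‖w‖ ≤ 1 := by
      have e2 : 0 ≤ ‖e q - e p‖ * (2 * A ^ 3 + 1) := by positivity
      linear_combination hw1 + hdr + e2
    have hPw : P p (ambientDeriv e p w) = w := hPe p w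
    have hDw : |‖P p (e q - e p)‖ - ‖w‖| ≤ B * ‖w‖ * ‖w‖ := by
      refine (abs_norm_sub_norm_le _ _).trans ?_
      have e1 := hPn p (e q - e p - ambientDeriv e p w)
      rw [map_sub, hPw] at e1
      have e2 := mul_le_mul_of_nonneg_left hw3 hA
      linear_combination e1 + e2
    have hDw2 : ‖w‖ ≤ 2 * ‖P p (e q - e p)‖ ∧ ‖P p (e q - e p)‖ ≤ 2 * ‖w‖ := by
      have e1 := mul_le_mul_of_nonneg_right hBw hw0
      have e2 := abs_le.1 hDw
      constructor <;> linarith [e2.1, e2.2]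
  · have hDf : |‖P (f p) (e (f q) - e (f p))‖ - lam p * ‖w‖| ≤ B * ‖w‖ ^ θ * ‖w‖ := by
      rw [← hlam p w]
      refine (abs_norm_sub_norm_le _ _).trans ?_
      have e1 := hPn (f p) (e (f q) - e (f p) - ambientDeriv (e ∘ f) p w)
      have e3 : P (f p) (ambientDeriv (e ∘ f) p w) = mfderiv (𝓡 d) (𝓡 d) f p w := by
        rw [hchain]; exact hPe (f p) _
      rw [map_sub, e3] at e1
      have e2 := mul_le_mul_of_nonneg_left hw4 hA
      linear_combination e1 + e2
    set D := ‖P p (e q - e p)‖ with hD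
    have hD0 : 0 ≤ D := norm_nonneg _
    have hlp : 0 < lam p := hl.trans_le (hlaml p)
    have hwθ : ‖w‖ * ‖w‖ ≤ ‖w‖ ^ θ * ‖w‖ := by
      refine mul_le_mul_of_nonneg_right ?_ hw0
      rcases hw0.eq_or_lt with h0 | h0
      · rw [← h0]; positivity
      · simpa using Real.rpow_le_rpow_of_exponent_ge h0 hw_le hθ
    have hpow : ‖w‖ ^ θ * ‖w‖ ≤ 4 * (D ^ θ * D) := by
      have e1 : ‖w‖ ^ θ ≤ 2 * D ^ θ :=
        calc ‖w‖ ^ θ ≤ (2 * D) ^ θ := Real.rpow_le_rpow hw0 hDw2.1 hθ0.le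
          _ = 2 ^ θ * D ^ θ := Real.mul_rpow (by norm_num) hD0
          _ ≤ 2 * D ^ θ := by
            refine mul_le_mul_of_nonneg_right ?_ (by positivity)
            simpa using Real.rpow_le_rpow_of_exponent_le (x := 2) (by norm_num) hθ
      calc ‖w‖ ^ θ * ‖w‖ ≤ 2 * D ^ θ * (2 * D) := mul_le_mul e1 hDw2.1 hw0 (by positivity)
        _ = _ := by ring
    have hmain : |‖P (f p) (e (f q) - e (f p))‖ - lam p * D| ≤
        B * (1 + L) * (‖w‖ ^ θ * ‖w‖) := by
      have e1 := abs_sub_le ‖P (f p) (e (f q) - e (f p))‖ (lam p * ‖w‖) (lam p * D)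
      have e2 : |lam p * ‖w‖ - lam p * D| ≤ L * (B * (‖w‖ ^ θ * ‖w‖)) := by
        rw [← mul_sub, abs_mul, abs_of_pos hlp, abs_sub_comm]
        refine mul_le_mul (hL p) (hDw.trans ?_) (abs_nonneg _) hL0.le
        rw [mul_assoc]
        exact mul_le_mul_of_nonneg_left hwθ hB0
      linear_combination e1 + e2 + hDf
    refine hmain.trans ?_
    have hDD : 0 ≤ D ^ θ * D := by positivity
    calc B * (1 + L) * (‖w‖ ^ θ * ‖w‖) ≤ B * (1 + L) * (4 * (D ^ θ * D)) :=
          mul_le_mul_of_nonneg_left hpow (by positivity)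
      _ = 4 * (B * (1 + L)) / l * (D ^ θ * (l * D)) := by field_simp
      _ ≤ 4 * (B * (1 + L)) / l * (D ^ θ * (lam p * D)) := by
          refine mul_le_mul_of_nonneg_left ?_ (by positivity)
          exact mul_le_mul_of_nonneg_left (mul_le_mul_of_nonneg_right (hlaml p) hD0)
            (by positivity)
      _ = _ := by ring
  · rw [hde]
    have e1 := mul_le_mul_of_nonneg_left hDw2.1 hA
    have hD0 : 0 ≤ ‖P p (e q - e p)‖ := norm_nonneg _
    constructor
    · linear_combination hw2 + e1 + hD0
    · linear_combination hDw2.2 + 2 * hw1 + hd0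

variable [CompactSpace M] [IsManifold (𝓡 d) ∞ M]
  [IsContMDiffRiemannianBundle (𝓡 d) ∞ (EuclideanSpace ℝ (Fin d))
    (fun x : M => TangentSpace (𝓡 d) x)]

theorem exists_conformal_factor (hd : 1 ≤ d) {n : ℕ} {f : M → M} {θ : ℝ≥0} (hθ0 : 0 < θ)
    (hθ : θ ≤ 1) (hf : IsC1Holder d θ f) (hexp : IsExpandingMap d f)
    (hconf : IsConformalEndomorphism d f) {e : M → EuclideanSpace ℝ (Fin n)}
    (he : ContMDiff (𝓡 d) 𝓘(ℝ, EuclideanSpace ℝ (Fin n)) ∞ e)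
    (hinj : ∀ x, Injective (mfderiv (𝓡 d) 𝓘(ℝ, EuclideanSpace ℝ (Fin n)) e x))
    (hdist : ∀ p q, dist p q = dist (e p) (e q)) :
    ∃ (lam : M → ℝ) (L C σ : ℝ), 0 < C ∧ 1 < σ ∧ (∀ p, 0 < lam p) ∧ (∀ p, lam p ≤ L) ∧
      (∀ k p, C * σ ^ k ≤ cocycleProd f lam k p) ∧
      HasBoundedDistortion f (cocycleProd f lam) := by
  choose c iso hc using hconf
  obtain ⟨C, σ, hC, hσ, hCσ⟩ := hexp
  set lam : M → ℝ := fun p => |c p| with hlam_def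
  have hlam : ∀ (p : M) (w : TangentSpace (𝓡 d) p),
      ‖mfderiv (𝓡 d) (𝓡 d) f p w‖ = lam p * ‖w‖ := fun p w => by
    rw [hc, norm_smul, LinearIsometry.norm_map, Real.norm_eq_abs]
  have hunit : ∀ p : M, ∃ w : TangentSpace (𝓡 d) p, 0 < ‖w‖ := fun p => by
    have : Nonempty (Fin d) := ⟨⟨0, hd⟩⟩
    obtain ⟨w, hw⟩ := exists_ne (0 : EuclideanSpace ℝ (Fin d))
    exact ⟨(w : TangentSpace (𝓡 d) p), norm_pos_iff.2 hw⟩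
  -- The expansion hypothesis tested on one non-zero vector, which exists because `d ≥ 1`.
  have hΛ : ∀ k p, C * σ ^ k ≤ cocycleProd f lam k p := fun k p => by
    obtain ⟨w, hw⟩ := hunit p
    have := hCσ k p w
    rw [norm_mfderiv_iterate hf.1 hlam] at this
    exact le_of_mul_le_mul_right this hw
  have hl : ∀ p, C * σ ≤ lam p := fun p => by
    simpa [cocycleProd] using hΛ 1 p
  have hCσ0 : 0 < C * σ := by positivity
  have hpos : ∀ p, 0 < lam p := fun p => hCσ0.trans_le (hl p)
  obtain ⟨A, r, hr, happ⟩ := exists_uniform_of_locally (P := HasTangentApprox d θ f e)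
    (fun A A' p q hA h => h.mono hA) (exists_hasTangentApprox_near hθ hf he hinj)
  have hself : ∀ p, HasTangentApprox d θ f e A p p := fun p => happ p p (by simpa using hr.le)
  -- An upper bound without continuity of `lam`: the tangent estimates at `p` and at `f p` already
  -- bound the derivative.
  have hL : ∀ p, lam p ≤ A * A := fun p => by
    obtain ⟨w, hw⟩ := hunit p
    have hchain : ambientDeriv (e ∘ f) p w =
        ambientDeriv e (f p) (mfderiv (𝓡 d) (𝓡 d) f p w) := by
      have := mfderiv_comp (I := 𝓡 d) (I' := 𝓡 d) (I'' := 𝓘(ℝ, EuclideanSpace ℝ (Fin n))) p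
        (he.mdifferentiableAt (by simp) (x := f p)) (hf.1.mdifferentiableAt (by simp) (x := p))
      unfold ambientDeriv
      rw [this]
      rfl
    have h1 := (hself (f p)).2.1 (mfderiv (𝓡 d) (𝓡 d) f p w)
    rw [← hchain, hlam] at h1
    have h2 := mul_le_mul_of_nonneg_left ((hself p).2.2.1 w) (hself p).1
    refine le_of_mul_le_mul_right ?_ hw
    linear_combination h1 + h2
  obtain ⟨D, r', A', c', hr', hA', hc', hD, hDd⟩ := exists_quasiDist (θ := θ)
    (by exact_mod_cast hθ0) (by exact_mod_cast hθ) hf.1 he hdist hr happ hCσ0 hl hlam hL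
  exact ⟨lam, A * A, C, σ, hC, hσ, hpos, hL, hΛ,
    hasBoundedDistortion_of_quasiDist (θ := θ) (by exact_mod_cast hθ0) hr' hA' hc' hC hσ hD hDd
      hpos hL hΛ (CompactSpace.uniformContinuous_of_continuous hf.1.continuous)⟩

end ConformalExpanding

/-! ### Passage to charts and conclusion -/

section Charts

variable {d n : ℕ} {M : Type*} [TopologicalSpace M] [ChartedSpace (EuclideanSpace ℝ (Fin d)) M]

/-- An embedding read in a `C¹` chart is bi-Lipschitz on compact subsets of the chart. -/
theorem exists_biLipschitz_chart {e : M → EuclideanSpace ℝ (Fin n)}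
    (he : ContMDiff (𝓡 d) 𝓘(ℝ, EuclideanSpace ℝ (Fin n)) ∞ e) (heinj : Injective e)
    (hinj : ∀ x, Injective (mfderiv (𝓡 d) 𝓘(ℝ, EuclideanSpace ℝ (Fin n)) e x))
    {φ : OpenPartialHomeomorph M (EuclideanSpace ℝ (Fin d))}
    (hφ : φ ∈ IsManifold.maximalAtlas (𝓡 d) 1 M) {Q : Set (EuclideanSpace ℝ (Fin d))}
    (hQ : IsCompact Q) (hQφ : Q ⊆ φ.target) :
    ∃ c : ℝ, 1 ≤ c ∧ ∀ x ∈ Q, ∀ y ∈ Q,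
      dist (e (φ.symm x)) (e (φ.symm y)) ≤ c * dist x y ∧
      dist x y ≤ c * dist (e (φ.symm x)) (e (φ.symm y)) := by
  have he1 : ContMDiff (𝓡 d) 𝓘(ℝ, EuclideanSpace ℝ (Fin n)) 1 e := he.of_le ENat.LEInfty.out
  have hφd : φ.MDifferentiable (𝓡 d) (𝓡 d) :=
    ⟨fun x hx => (mdifferentiableAt_of_mem_maximalAtlas hφ hx).mdifferentiableWithinAt,
      fun x hx => (mdifferentiableAt_symm_of_mem_maximalAtlas hφ hx).mdifferentiableWithinAt⟩
  refine exists_biLipschitz_on_compact (h := e ∘ φ.symm) hQ (fun x hx => ?_) (fun x hx => ?_)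
    (fun x hx y hy hxy => ?_)
  · exact (he1.contMDiffAt.comp x (contMDiffAt_symm_of_mem_maximalAtlas hφ (hQφ hx))).contDiffAt
  · rw [← mfderiv_eq_fderiv, mfderiv_comp x (he1.mdifferentiableAt (by simp))
      (hφd.mdifferentiableAt_symm (hQφ hx))]
    exact (hinj _).comp (hφd.symm.mfderiv_injective (hQφ hx))
  · exact φ.symm.injOn (hQφ hx) (hQφ hy) (heinj hxy)

end Charts

/-- The orbit lies in a finite set together with a closed set away from `y`. This union is closed,
so the orbit closure can contain `y` only if an early iterate equals `y`. -/
theorem mem_avoidingSet {M : Type*} [MetricSpace M] {f : M → M} {Y : Set M} {z : M}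
    (hfar : ∀ y ∈ Y, ∃ δ > 0, ∃ k₀ : ℕ, ∀ k ≥ k₀, δ ≤ dist (f^[k] z) y)
    (hne : ∀ y ∈ Y, ∀ k, f^[k] z ≠ y) : z ∈ avoidingSet f Y := by
  refine eq_empty_iff_forall_notMem.2 ?_
  rintro y ⟨hy, hcl⟩
  obtain ⟨δ, hδ, k₀, hk₀⟩ := hfar y hy
  have hsub : {w | ∃ k : ℕ, f^[k] z = w} ⊆
      (fun k => f^[k] z) '' Iio k₀ ∪ {w | δ ≤ dist w y} := by
    rintro _ ⟨k, rfl⟩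
    rcases lt_or_ge k k₀ with hk | hk
    exacts [Or.inl ⟨k, hk, rfl⟩, Or.inr (hk₀ k hk)]
  have hclosed : IsClosed ((fun k => f^[k] z) '' Iio k₀ ∪ {w | δ ≤ dist w y}) :=
    ((finite_Iio k₀).image _).isClosed.union
      (isClosed_le continuous_const (continuous_id.dist continuous_const))
  rcases closure_minimal hsub hclosed hcl with ⟨k, -, hk⟩ | hy'
  · exact hne y hy k hk
  · rw [mem_ofPred_eq, dist_self] at hy'
    exact absurd hδ (not_lt.2 hy')

theorem corollary1p3 (d : ℕ) (hd : 1 ≤ d)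
    {M : Type*} [TopologicalSpace M] [T2Space M] [CompactSpace M]
    [ChartedSpace (EuclideanSpace ℝ (Fin d)) M] [IsManifold (𝓡 d) ∞ M]
    [Bundle.RiemannianBundle (fun x : M => TangentSpace (𝓡 d) x)]
    [IsContMDiffRiemannianBundle (𝓡 d) ∞ (EuclideanSpace ℝ (Fin d))
      (fun x : M => TangentSpace (𝓡 d) x)]
    {ι : Type*} [Countable ι] (f : ι → M → M) (θ : ι → ℝ≥0)
    (hθ_pos : ∀ i, 0 < θ i) (hθ_le : ∀ i, θ i ≤ 1)
    (hf_holder : ∀ i, IsC1Holder d (θ i) (f i))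
    (hf_expanding : ∀ i, IsExpandingMap d (f i))
    (hf_conformal : ∀ i, IsConformalEndomorphism d (f i))
    (Y : Set M) (hY : Y.Countable) :
    IsAbsoluteWinning d (⋂ i, avoidingSet (f i) Y) := by
  obtain ⟨n, e, he, hemb, hinj⟩ := exists_embedding_euclidean_of_compact (I := 𝓡 d) (M := M)
  -- An auxiliary chordal metric inducing the given topology; the Riemannian distance plays no role.
  let : MetricSpace M := hemb.isEmbedding.comapMetricSpace e
  have hdist : ∀ p q, dist p q = dist (e p) (e q) := fun _ _ => rfl
  choose lam L C σ hC hσ hlam hL hexp hbd using fun i =>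
    exists_conformal_factor hd (hθ_pos i) (hθ_le i) (hf_holder i) (hf_expanding i)
      (hf_conformal i) he hinj hdist
  have hcont : ∀ i, Continuous (f i) := fun i => (hf_holder i).1.continuous
  intro φ hφ
  refine isAbsoluteWinningOn_of_winsShrinkingPlays hd fun β hβ hβ3 => ?_
  have hg : ∀ b : GameBall d, b.toSet ⊆ φ.target → ∃ c : ℝ, 1 ≤ c ∧ ∀ x ∈ b.toSet, ∀ x' ∈ b.toSet,
      dist (φ.symm x) (φ.symm x') ≤ c * dist x x' ∧ dist x x' ≤ c * dist (φ.symm x) (φ.symm x') :=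
    fun b hb => exists_biLipschitz_chart he hemb.injective hinj hφ (isCompact_closedBall _ _) hb
  have : Countable Y := hY
  -- All points whose orbits hit `Y` exactly. The set is countable because each iterate has
  -- countable fibres.
  set Z : Set (EuclideanSpace ℝ (Fin d)) :=
    φ '' ⋃ (i : ι) (y : Y) (k : ℕ), {z | (f i)^[k] z = y} with hZ
  have hZc : Z.Countable := by
    refine Set.Countable.image (countable_iUnion fun i => countable_iUnion fun y =>
      countable_iUnion fun k => ?_) _
    exact countable_iterate_preimage_singleton (hlam i) (hL i) (hbd i) k y
  have : Countable Z := hZc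
  refine (winsShrinkingPlays_iInter (ι := (ι × Y) ⊕ Z) hβ hβ3
    (S := Sum.elim (fun j => {x | ∃ δ > 0, ∃ k₀ : ℕ, ∀ k ≥ k₀,
      δ ≤ dist ((f j.1)^[k] (φ.symm x)) j.2}) (fun z => {(z : EuclideanSpace ℝ (Fin d))}ᶜ))
    ?_).mono ?_
  · rintro (⟨i, y⟩ | z) β' hβ' hβ3'
    · exact winsShrinkingPlays_eventually_far (hcont i) (hlam i) (hL i) (hC i) (hσ i) (hexp i)
        (hbd i) y hβ' (by linarith) φ.symm hg
    · exact winsShrinkingPlays_compl_singleton hβ' _ _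
  · rintro x ⟨hxW, hx⟩
    rw [mem_iInter] at hx
    refine ⟨φ.symm x, ⟨mem_iInter.2 fun i => mem_avoidingSet (fun y hy => hx (Sum.inl (i, ⟨y, hy⟩)))
      fun y hy k hk => ?_, φ.map_target hxW⟩, φ.right_inv hxW⟩
    have hxZ : x ∈ Z := ⟨φ.symm x, mem_iUnion.2 ⟨i, mem_iUnion.2 ⟨⟨y, hy⟩, mem_iUnion.2 ⟨k, hk⟩⟩⟩,
      φ.right_inv hxW⟩
    exact hx (Sum.inr ⟨x, hxZ⟩) rfl
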